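/- Let $L$ be a first-order language containing the language $\{0,1,+,\cdot\}$ of Peano arithmetic, interpreted on $\mathbb N$ so that $0,1,+,\cdot$ have their usual meaning (nothing else, such as countability or definability in PA, is required of $L$). Let $\mathcal M$ be an $\aleph_1$-saturated $L$-structure elementarily equivalent to $\mathbb N$. Finite sets and functions are coded in $\mathcal M$ by numbers in the usual way (a number codes the set of the positions of the digits $1$ in its binary expansion, a function is the set of its pairs); $|s|$ is the cardinality, in the sense of $\mathcal M$, of the set coded by $s$. Let $\Omega\in\mathcal M$ code an infinite set and let $F\subseteq\mathcal M$ be a family of (codes of) functions $\alpha:\Omega\to\mathcal M$. Let $\mathcal B$ be the Boolean algebra of subsets of $\Omega$ that are definable in $\mathcal M$ with parameters, modulo the ideal $\mathcal I$ of the sets $U$ with $|U|/|\Omega|$ infinitesimal (that is, $k|U|\le|\Omega|$ for all standard $k$). The elements of $F$ serve as constants of the language $L(F)$; an open formula is a quantifier-free one. For $\omega\in\Omega$, an $L(F)$-formula is evaluated at $\omega$ in $\mathcal M$ by replacing each constant $\alpha\in F$ by $\alpha(\omega)$. The Boolean-valued structure $K(F)$ has universe $F$; the truth value $[\![A]\!]\in\mathcal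 B$ of an atomic $L(F)$-sentence $A$ is the class modulo $\mathcal I$ of $\{\omega\in\Omega : A \text{ holds at } \omega\}$, truth values commute with Boolean connectives, and $[\![\exists x A(x)]\!]=\bigvee_{\alpha\in F}[\![A(\alpha)]\!]$, $[\![\forall x A(x)]\!]=\bigwedge_{\alpha\in F}[\![A(\alpha)]\!]$. Assume that - $F$ is $L$-closed: for every $n$-ary function symbol $f$ of $L$ (constants included) and $\alpha_1,\dots,\alpha_n\in F$, the function $\omega\mapsto f(\alpha_1(\omega),\dots,\alpha_n(\omega))$ on $\Omega$ is in $F$; - $F$ is closed under definition by cases by open formulas: for all $\alpha,\beta\in F$ and every open $L(F)$-formula $B(x)$ with the one free variable $x$ there is $\gamma\in F$ such that, for all $\omega\in\Omega$, $\gamma(\omega)=\alpha(\omega)$ if $B(\alpha(\omega))$ holds at $\omega$, and $\gamma(\omega)=\beta(\omega)$ otherwise; - $F$ is compact: there is an $L$-formula $H(x,y)$, possibly with parameters from $\mathcal M$, such that the sets $F_k=\{b\in\mathcal M : \mathcal M\models H(k,b)\}$, $k\in\mathbb N$, satisfy $F_k\supseteq F_{k+1}$ for all $k$ and $\bigcap_{k\in\mathbb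 N}F_k=F$. Theorem 3.2. The Boolean algebra $\mathcal B$ is complete, and for every countable set $\mathbf p$ of open $L(F)$-formulas in one free variable $x$ there is $\alpha\in F$ such that $$\bigwedge_{\Phi\subseteq_f\mathbf p}\Bigl[\!\!\Bigl[\exists x\bigwedge_{A\in\Phi}A(x)\Bigr]\!\!\Bigr]\ \le\ \bigwedge_{A\in\mathbf p}[\![A(\alpha)]\!],$$ where $\Phi$ ranges over the finite subsets of $\mathbf p$. In other words, $K(F)$ is saturated for countable open types. -/

import Mathlib

open FirstOrder

universe u v w

/-- Function symbols of the language of Peano arithmetic. -/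
inductive ArithFunc : ℕ → Type
  | zero : ArithFunc 0
  | one : ArithFunc 0
  | add : ArithFunc 2
  | mul : ArithFunc 2

/-- The language `{0, 1, +, ·}` of Peano arithmetic. -/
def arithLang : FirstOrder.Language.{0, 0} where
  Functions := ArithFunc
  Relations := fun _ => Empty

/-- The standard model of arithmetic. -/
instance arithLangStructureNat : arithLang.Structure ℕ where
  funMap := fun f =>
    match f with
    | .zero => fun _ => 0
    | .one => fun _ => 1
    | .add => fun x => x 0 + x 1
    | .mul => fun x => x 0 * x 1
  RelMap := fun r => r.elim

/-- `ℵ₁`-saturation: every set of formulas in one free variable, with parameters from a countable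
set `C`, that is finitely satisfiable in `M` is realized in `M`. -/
def Aleph1Saturated (L : FirstOrder.Language.{u, v}) (M : Type w) [L.Structure M] : Prop :=
  ∀ C : Set M, C.Countable → ∀ q : Set (L[[C]].Formula (Fin 1)),
    (∀ Φ : Finset (L[[C]].Formula (Fin 1)), (Φ : Set (L[[C]].Formula (Fin 1))) ⊆ q →
      ∃ m : M, ∀ φ ∈ Φ, φ.Realize (fun _ => m)) →
    ∃ m : M, ∀ φ ∈ q, φ.Realize (fun _ => m)

namespace RandomForcing

/-- The standard number `k` as an element of `M`, i.e. the value of `0 + 1 + ⋯ + 1`; here `ι`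
embeds the language of arithmetic into `L`. -/
def numeral {L : FirstOrder.Language.{u, v}} (ι : arithLang →ᴸ L) (M : Type w) [L.Structure M] :
    ℕ → M
  | 0 => Language.Structure.funMap (ι.onFunction ArithFunc.zero) ![]
  | k + 1 => Language.Structure.funMap (ι.onFunction ArithFunc.add)
      (![numeral ι M k, (Language.Structure.funMap (ι.onFunction ArithFunc.one) ![])])

theorem realize_iAlls_iff (L : FirstOrder.Language.{u, v}) (N : Type w) [L.Structure N] {n : ℕ} (φ ψ : L.Formula (Fin n)) :
    N ⊨ ((((φ.iff ψ).relabel Sum.inr : L.Formula (Empty ⊕ Fin n))).iAlls (Fin n) : L.Sentence) ↔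
      ∀ y : Fin n → N, φ.Realize y ↔ ψ.Realize y := by
  simp [Language.Sentence.Realize, Language.Formula.realize_iAlls,
    Language.Formula.realize_relabel, Language.Formula.realize_iff, Function.comp_def]

section Coding

variable (L : FirstOrder.Language.{u, v}) [L.Structure ℕ] {M : Type w} [L.Structure M]

/-- The interpretation in `M` of an arithmetical relation `R` on `ℕ`: interpret in `M` a formula
that defines `R` in `ℕ`. If `M` is elementarily equivalent to `ℕ`, this does not depend on the
formula (`mem_star_iff`). It is used below only for primitive recursive relations `R`, all of
which are definable in `ℕ`. -/
def star {n : ℕ} (R : Set (Fin n → ℕ)) : Set (Fin n → M) :=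
  {x | ∃ h : ∃ φ : L.Formula (Fin n), ∀ a : Fin n → ℕ, φ.Realize a ↔ a ∈ R,
    h.choose.Realize x}

/-- The formula chosen in the definition of `star` does not matter. -/
theorem mem_star_iff (hM : L.ElementarilyEquivalent ℕ M) {n : ℕ} {R : Set (Fin n → ℕ)}
    (φ : L.Formula (Fin n)) (hφ : ∀ a : Fin n → ℕ, φ.Realize a ↔ a ∈ R) (x : Fin n → M) :
    x ∈ star L R ↔ φ.Realize x := by
  have h : ∃ φ : L.Formula (Fin n), ∀ a : Fin n → ℕ, φ.Realize a ↔ a ∈ R := ⟨φ, hφ⟩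
  have key : ∀ y : Fin n → M, h.choose.Realize y ↔ φ.Realize y :=
    (realize_iAlls_iff L M _ _).1 ((hM.realize_sentence _).1
      ((realize_iAlls_iff L ℕ _ _).2 fun a => (h.choose_spec a).trans (hφ a).symm))
  exact ⟨fun ⟨_, hx⟩ => (key x).1 hx, fun hx => ⟨h, (key x).2 hx⟩⟩

theorem definable_star {n : ℕ} (R : Set (Fin n → ℕ)) (A : Set M) :
    A.Definable L (star L R : Set (Fin n → M)) := by
  refine Set.Definable.mono (A := ∅) ?_ (Set.empty_subset A)
  rw [Set.empty_definable_iff]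
  by_cases h : ∃ φ : L.Formula (Fin n), ∀ a : Fin n → ℕ, φ.Realize a ↔ a ∈ R
  · exact ⟨h.choose, Set.ext fun x => ⟨fun ⟨_, hx⟩ => hx, fun hx => ⟨h, hx⟩⟩⟩
  · exact ⟨⊥, Set.ext fun x => ⟨fun ⟨h', _⟩ => (h h').elim, fun hx => hx.elim⟩⟩

/-- `x ∈ s` in `M`, for numbers as codes of finite sets: the `x`-th binary digit of `s` is `1`. -/
def Mem (x s : M) : Prop :=
  ![x, s] ∈ (star L {a : Fin 2 → ℕ | (a 1).testBit (a 0) = true} : Set (Fin 2 → M))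

/-- The `M`-finite set coded by `Ω`. -/
def elts (Ω : M) : Set M := {x | Mem L x Ω}

/-- `⟨x, y⟩ ∈ b` in `M`, with the pairing `Nat.pair` (a bijection of `ℕ × ℕ` and `ℕ`). -/
def PairMem (b x y : M) : Prop :=
  ![b, x, y] ∈
    (star L {a : Fin 3 → ℕ | (a 0).testBit (Nat.pair (a 1) (a 2)) = true} : Set (Fin 3 → M))

/-- `k · |s| ≤ |t|` in `M`, for the sets coded by `s` and `t` and a standard `k`. The cardinality
of the set coded by a number is the number of digits `1` in its binary expansion. -/
def MulCardLE (k : ℕ) (s t : M) : Prop :=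
  ![s, t] ∈
    (star L {a : Fin 2 → ℕ | k * (a 0).bitIndices.length ≤ (a 1).bitIndices.length} :
      Set (Fin 2 → M))

/-- The element `b` of `M` is (the code of the graph of) a function from `Ω` to `M`. -/
def IsRandomVariable (Ω b : M) : Prop :=
  (∀ x ∈ elts L Ω, ∃! y, PairMem L b x y) ∧ ∀ x y, PairMem L b x y → x ∈ elts L Ω

open Classical in
/-- The value `b(x)` of the function coded by `b`. (If there is no such value, it is `x`.) -/
noncomputable def ev (b x : M) : M :=
  if h : ∃! y, PairMem L b x y then h.choose else x

theorem definable_pairMem {α : Type} (b : M) (i j : α) :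
    (Set.univ : Set M).Definable L {f : α → M | PairMem L b (f i) (f j)} := by
  have hF : (Set.univ : Set M).DefinableMap L (fun f : α → M => ![b, f i, f j]) := by
    intro k
    fin_cases k
    · exact L.definableFun_const α (Set.mem_univ b)
    · exact Set.DefinableFun.proj L
    · exact Set.DefinableFun.proj L
  exact (definable_star L {a : Fin 3 → ℕ | (a 0).testBit (Nat.pair (a 1) (a 2)) = true}
    Set.univ).preimage_map hF

theorem definable_existsUnique {α : Type} (b : M) (i : α) :
    (Set.univ : Set M).Definable L {f : α → M | ∃! y, PairMem L b (f i) y} := by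
  have h1 : (Set.univ : Set M).Definable L
      {f : (α ⊕ Fin 1) ⊕ Fin 1 → M | PairMem L b (f (.inl (.inl i))) (f (.inr 0))}ᶜ :=
    (definable_pairMem L b _ _).compl
  have h2 : (Set.univ : Set M).Definable L
      {f : (α ⊕ Fin 1) ⊕ Fin 1 → M | f (.inr 0) = f (.inl (.inr 0))} :=
    Set.DefinableFun.ofPred_eq (Set.DefinableFun.proj L) (Set.DefinableFun.proj L)
  have h3 := (h1.union h2).forall_of_finite
  have h4 := (definable_pairMem L b (.inl i : α ⊕ Fin 1) (.inr 0)).inter h3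
  convert h4.exists_of_finite using 1
  ext f
  constructor
  · rintro ⟨y, hy, hu⟩
    refine ⟨fun _ => y, hy, fun z => ?_⟩
    by_cases hz : PairMem L b (f i) (z 0)
    · exact Or.inr (hu _ hz)
    · exact Or.inl hz
  · rintro ⟨y, hy, hu⟩
    refine ⟨y 0, hy, fun z hz => ?_⟩
    rcases hu (fun _ => z) with h | h
    · exact (h hz).elim
    · exact h

theorem definableFun_ev {α : Type} (b : M) (i : α) :
    (Set.univ : Set M).DefinableFun L (fun f : α → M => ev L b (f i)) := by
  have h1 := (definable_existsUnique L b (some i)).inter (definable_pairMem L b (some i) none)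
  have h2 := (definable_existsUnique L b (some i)).compl.inter
    (Set.DefinableFun.ofPred_eq (A := Set.univ) (L := L) (M := M)
      (f := fun f : Option α → M => f (some i)) (g := fun f => f none)
      (Set.DefinableFun.proj L) (Set.DefinableFun.proj L))
  unfold Set.DefinableFun
  convert h1.union h2 using 1
  ext f
  by_cases h : ∃! y, PairMem L b (f (some i)) y
  · have he : ev L b (f (some i)) = h.choose := dif_pos h
    simp only [Function.tupleGraph, Set.mem_ofPred_eq, Set.mem_union, Set.mem_inter_iff,
      Set.mem_compl_iff, h, not_true_eq_false, false_and, or_false, true_and,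
      Function.comp_apply, he]
    exact ⟨fun hf => hf ▸ h.choose_spec.1, fun hf => (h.choose_spec.2 _ hf).symm⟩
  · have he : ev L b (f (some i)) = f (some i) := dif_neg h
    simp only [Function.tupleGraph, Set.mem_ofPred_eq, Set.mem_union, Set.mem_inter_iff,
      Set.mem_compl_iff, h, not_false_eq_true, false_and, false_or, true_and,
      Function.comp_apply, he]

end Coding

section Algebra

variable (L : FirstOrder.Language.{u, v}) [L.Structure ℕ] {M : Type w} [L.Structure M]

/-- The Boolean algebra of the `M`-definable (with parameters) subsets of `Ω`. -/
def definableSubsets (Ω : M) : BooleanSubalgebra (Set (elts L Ω)) where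
  carrier := {S | ∃ D : Set M, (Set.univ : Set M).Definable₁ L D ∧ S = Subtype.val ⁻¹' D}
  supClosed' := by
    rintro _ ⟨D, hD, rfl⟩ _ ⟨E, hE, rfl⟩
    exact ⟨D ∪ E, hD.union hE, rfl⟩
  infClosed' := by
    rintro _ ⟨D, hD, rfl⟩ _ ⟨E, hE, rfl⟩
    exact ⟨D ∩ E, hD.inter hE, rfl⟩
  compl_mem' := by
    rintro _ ⟨D, hD, rfl⟩
    exact ⟨Dᶜ, hD.compl, rfl⟩
  bot_mem' := ⟨∅, Set.definable_empty, rfl⟩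

/-- The counting measure `|U| / |Ω|` of `U ⊆ Ω` is infinitesimal: `U` is coded by some `s` in `M`
and `k · |s| ≤ |Ω|` for all standard `k`. -/
def IsInfinitesimal (Ω : M) (U : Set (elts L Ω)) : Prop :=
  ∃ s : M, (∀ x, x ∈ elts L s ↔ ∃ h : x ∈ elts L Ω, (⟨x, h⟩ : elts L Ω) ∈ U) ∧
    ∀ k : ℕ, MulCardLE L k s Ω

/-- The ideal of the sets of infinitesimal counting measure. (These sets are closed under
subsets and finite unions, so generating an ideal adds nothing to them.) -/
def infinitesimalIdeal (Ω : M) : Ideal (AsBoolRing (definableSubsets L Ω)) :=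
  Ideal.span {U | IsInfinitesimal L Ω ((ofBoolRing U : definableSubsets L Ω) : Set (elts L Ω))}

/-- The quotient of the Boolean ring of definable subsets of `Ω` by the infinitesimal ideal. -/
abbrev QuotRing (Ω : M) : Type w :=
  AsBoolRing (definableSubsets L Ω) ⧸ infinitesimalIdeal L Ω

instance (Ω : M) : BooleanRing (QuotRing L Ω) where
  isIdempotentElem := by
    intro a
    obtain ⟨a, rfl⟩ := Ideal.Quotient.mk_surjective a
    exact (map_mul _ a a).symm.trans (congrArg _ (BooleanRing.mul_self a))

/-- The Boolean algebra `𝓑` of truth values: definable subsets of `Ω` modulo sets of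
infinitesimal counting measure. -/
abbrev TruthValues (Ω : M) : Type w := AsBoolAlg (QuotRing L Ω)

/-- The class in `𝓑` of a definable subset of `Ω`. -/
def cls (Ω : M) (U : definableSubsets L Ω) : TruthValues L Ω :=
  toBoolAlg (Ideal.Quotient.mk (infinitesimalIdeal L Ω) (toBoolRing U))

end Algebra

open Classical in
/-- The greatest lower bound of `S`. (It is `⊥` if there is none, which does not happen in a
complete Boolean algebra.) -/
noncomputable def glb {X : Type w} [BooleanAlgebra X] (S : Set X) : X :=
  if h : ∃ b, IsGLB S b then h.choose else ⊥

theorem isGLB_glb {X : Type w} [BooleanAlgebra X] {S : Set X} (h : ∃ b, IsGLB S b) :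
    IsGLB S (glb S) := by
  rw [glb, dif_pos h]
  exact h.choose_spec

section Formulas

variable (L : FirstOrder.Language.{u, v}) [L.Structure ℕ] {M : Type w} [L.Structure M]
  (Ω : M) (F : Set M)

/-- The value at `x` of an `L(F)`-term, its constants and variables being random variables. -/
noncomputable def termVal {n : ℕ} (t : L.Term (F ⊕ Fin n)) (e : Fin n → F) (x : M) : M :=
  t.realize (Sum.elim (fun α : F => ev L (α : M) x) (fun i => ev L (e i : M) x))

theorem definableFun_termVal {n : ℕ} (t : L.Term (F ⊕ Fin n)) (e : Fin n → F) :
    (Set.univ : Set M).DefinableFun L (fun f : Fin 1 → M => termVal L F t e (f 0)) := by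
  induction t with
  | var i =>
    rcases i with α | i
    · exact definableFun_ev L (α : M) 0
    · exact definableFun_ev L (e i : M) 0
  | func f ts ih =>
    exact Set.DefinableFun.comp (g := fun (y : Fin 1 → M) i => termVal L F (ts i) e (y 0))
      ih (Set.DefinableFun.fun_symbol f).of_empty

/-- The set of all `x ∈ Ω` where `t₁ = t₂` holds, for `L(F)`-terms `t₁`, `t₂`. -/
noncomputable def eqSet {n : ℕ} (t₁ t₂ : L.Term (F ⊕ Fin n)) (e : Fin n → F) :
    definableSubsets L Ω :=
  ⟨{x | termVal L F t₁ e x = termVal L F t₂ e x},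
    {x | termVal L F t₁ e x = termVal L F t₂ e x},
    (definableFun_termVal L F t₁ e).ofPred_eq (definableFun_termVal L F t₂ e), rfl⟩

/-- The set of all `x ∈ Ω` where `R(t₁, …, t_l)` holds, for `L(F)`-terms `t₁, …, t_l`. -/
noncomputable def relSet {n l : ℕ} (R : L.Relations l) (ts : Fin l → L.Term (F ⊕ Fin n))
    (e : Fin n → F) : definableSubsets L Ω :=
  ⟨{x | Language.Structure.RelMap R fun i => termVal L F (ts i) e (x : M)},
    {x | Language.Structure.RelMap R fun i => termVal L F (ts i) e x}, by
      have hR : (Set.univ : Set M).Definable L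
          {y : Fin l → M | Language.Structure.RelMap R y} := by
        refine Set.Definable.mono (A := ∅) ?_ (Set.empty_subset _)
        rw [Set.empty_definable_iff]
        refine ⟨R.formula fun i => Language.Term.var i, Set.ext fun y => ?_⟩
        simp [Language.Formula.realize_rel]
      exact hR.preimage_map (F := fun (y : Fin 1 → M) i => termVal L F (ts i) e (y 0))
        fun i => definableFun_termVal L F (ts i) e, rfl⟩

/-- The truth value in `K(F)` of an `L(F)`-formula with `n` free variables, when these are
interpreted by elements of `F`. An `L(F)`-formula is an element of `L.BoundedFormula F n`, with
the elements of `F` in the role of constants; for `n = 0` it is an `L(F)`-sentence. The atomic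
formulas are evaluated pointwise on `Ω`, truth values commute with the connectives (the primitive
ones are `⊥` and `→`), and `∀` is the infimum over `F`. As `∃` abbreviates `¬∀¬`, it is the supremum
over `F` (`truth_ex`). -/
noncomputable def truth : ∀ {n : ℕ}, L.BoundedFormula F n → (Fin n → F) → TruthValues L Ω
  | _, .falsum, _ => ⊥
  | _, .equal t₁ t₂, e => cls L Ω (eqSet L Ω F t₁ t₂ e)
  | _, .rel R ts, e => cls L Ω (relSet L Ω F R ts e)
  | _, .imp φ ψ, e => truth φ e ⇨ truth ψ e
  | _, .all φ, e => glb (Set.range fun α : F => truth φ (Fin.snoc e α))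

theorem truth_ex {n : ℕ} (φ : L.BoundedFormula F (n + 1)) (e : Fin n → F)
    (hB : ∀ S : Set (TruthValues L Ω), ∃ b, IsGLB S b) :
    IsLUB (Set.range fun α : F => truth L Ω F φ (Fin.snoc e α)) (truth L Ω F φ.ex e) := by
  have h : IsGLB (Set.range fun α : F => truth L Ω F φ (Fin.snoc e α) ⇨ ⊥)
      (truth L Ω F φ.ex e)ᶜ := by
    have hg := isGLB_glb (hB (Set.range fun α : F => truth L Ω F φ (Fin.snoc e α) ⇨ ⊥))
    have : truth L Ω F φ.ex e =
        glb (Set.range fun α : F => truth L Ω F φ (Fin.snoc e α) ⇨ ⊥) ⇨ ⊥ := rfl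
    rw [this, himp_bot, compl_compl]
    exact hg
  constructor
  · rintro _ ⟨α, rfl⟩
    have := h.1 ⟨α, rfl⟩
    simpa using this
  · intro b hb
    have : bᶜ ≤ (truth L Ω F φ.ex e)ᶜ := h.2 (by
      rintro _ ⟨α, rfl⟩
      simpa using hb ⟨α, rfl⟩)
    exact compl_le_compl_iff_le.1 this

/-- `F` is `L`-closed: `f(α₁, …, α_n)`, computed pointwise on `Ω`, is in `F` whenever
`α₁, …, α_n` are. -/
def LClosed : Prop :=
  ∀ (n : ℕ) (f : L.Functions n) (α : Fin n → F), ∃ γ : F, ∀ x ∈ elts L Ω,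
    ev L (γ : M) x = Language.Structure.funMap f fun i => ev L (α i : M) x

/-- `F` is closed under definition by cases by open (quantifier-free) `L(F)`-formulas in one free
variable. -/
def ClosedUnderCases : Prop :=
  ∀ (α β : F) (B : L.BoundedFormula F 1), B.IsQF → ∃ γ : F, ∀ x ∈ elts L Ω,
    (B.Realize (fun δ : F => ev L (δ : M) x) (fun _ => ev L (α : M) x) →
      ev L (γ : M) x = ev L (α : M) x) ∧
    (¬ B.Realize (fun δ : F => ev L (δ : M) x) (fun _ => ev L (α : M) x) →
      ev L (γ : M) x = ev L (β : M) x)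

end Formulas

/-- `F` is compact: for some `L`-formula `H(x, y)`, possibly with parameters from `M`, the sets
`F_k = {b | M ⊨ H(k, b)}`, `k` standard, decrease and have intersection `F`. -/
def Compact {L : FirstOrder.Language.{u, v}} (ι : arithLang →ᴸ L) {M : Type w} [L.Structure M]
    (F : Set M) : Prop :=
  ∃ H : L.Formula (M ⊕ Fin 2),
    (⋂ k : ℕ, {b : M | H.Realize (Sum.elim id ![numeral ι M k, b])}) = F ∧
    ∀ k : ℕ, {b : M | H.Realize (Sum.elim id ![numeral ι M (k + 1), b])} ⊆
      {b : M | H.Realize (Sum.elim id ![numeral ι M k, b])}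

/-- The saturation inequality: `u ∈ F` satisfies
`⋀_Φ ⟦∃ x ⋀_{A ∈ Φ} A(x)⟧ ≤ ⋀_{A ∈ p} ⟦A(u)⟧`, with `Φ` ranging over the finite subsets of `p`. -/
def RealizesSatur (L : FirstOrder.Language.{u, v}) [L.Structure ℕ] {M : Type w} [L.Structure M]
    (Ω : M) (F : Set M) (p : Set (L.BoundedFormula F 1)) (u : F) : Prop :=
  glb {b : TruthValues L Ω | ∃ Φ : Finset (L.BoundedFormula F 1),
      (Φ : Set (L.BoundedFormula F 1)) ⊆ p ∧
      b = truth L Ω F (Language.BoundedFormula.iInf fun A : Φ => (A : L.BoundedFormula F 1)).ex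
        ![]} ≤
    glb {b : TruthValues L Ω | ∃ A ∈ p, b = truth L Ω F A ![u]}

end RandomForcing

/-! The standard part of |U|/|Ω| is a finitely additive probability `measure` on the definable
subsets of Ω, and its null sets are exactly the members of the ideal (`mem_infinitesimalIdeal`). By
ℵ₁-saturation, an increasing sequence of definable sets is contained in a definable set whose
measure exceeds no common bound of theirs (`exists_upperBound_measure_le`). Given an upward directed
family, choose an increasing sequence in it whose measures tend to the supremum. The enclosing set W
is then a union of the family up to null sets, and members of the family approximate W in measure
(`exists_null_union`). Applied to finite unions of representatives, this gives completeness of 𝓑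
(`exists_isLUB`).

For the type p, let T represent the left side of the inequality. For open A, ⟦∃x A⟧ is the supremum
of the classes of the sets where A(α) holds. Definition by cases makes these sets a directed family
(`directedOn_openSet`), so one α ∈ F satisfies A on T up to measure ε. Hence, for a finite part of p
and a standard k, one α ∈ F makes each chosen formula fail only on a part of T of size at most
|Ω|/k. The requirements of this kind on u, together with H(k, u) for all k, are countably many
definable conditions, and they are finitely satisfiable. Saturation yields u, compactness puts u in
F, and T minus ⟦A(u)⟧ is infinitesimal for every A in p (`exists_realizesSatur`).

The counting facts behind `measure` are proved for finite sets of natural numbers and carried to M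
by elementary equivalence (`Transfers`). This needs the digit and cardinality relations to be
definable from + and · in ℕ, which Gödel's β function provides. -/

namespace RandomForcing

/-! ### Arithmetical definability of primitive recursive functions -/

section Arithmetic

open Set

variable {α : Type} {f g : (α → ℕ) → ℕ}

theorem definableFun_reindex {L : FirstOrder.Language.{u, v}} {M : Type w} [L.Structure M]
    {A : Set M} {α β : Type*} {f : (α → M) → M}
    (hf : A.DefinableFun L f) (e : α → β) : A.DefinableFun L fun w : β → M => f (w ∘ e) := by
  have := Set.Definable.preimage_comp (Option.map e) hf
  unfold Set.DefinableFun
  convert this using 1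
  ext w
  simp [Function.tupleGraph, Function.comp_def]

/-- The quantified variable is `none` and the remaining ones are `some _`; nested quantifiers
therefore give towers of `Option`. -/
theorem definable_exists {L : FirstOrder.Language.{u, v}} {M : Type w} [L.Structure M]
    {A : Set M} {α : Type*} {P : (Option α → M) → Prop} (h : A.Definable L {w | P w}) :
    A.Definable L {v : α → M | ∃ y, P fun o => o.elim y v} := by
  have h' := (h.preimage_comp
    (fun o => o.elim (Sum.inr 0) Sum.inl : Option α → α ⊕ Fin 1)).exists_of_finite
  convert h' using 1
  ext v
  have key (u : Fin 1 → M) : (Sum.elim v u ∘ fun o : Option α => o.elim (Sum.inr 0) Sum.inl) =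
      fun o => o.elim (u 0) v := by
    funext o; cases o <;> rfl
  simp only [mem_ofPred_eq, mem_preimage, key]
  exact ⟨fun ⟨y, hy⟩ => ⟨fun _ => y, hy⟩, fun ⟨u, hu⟩ => ⟨u 0, hu⟩⟩

theorem definable_forall {L : FirstOrder.Language.{u, v}} {M : Type w} [L.Structure M]
    {A : Set M} {α : Type*} {P : (Option α → M) → Prop} (h : A.Definable L {w | P w}) :
    A.Definable L {v : α → M | ∀ y, P fun o => o.elim y v} := by
  have := (definable_exists (P := fun w => ¬ P w) h.compl).compl
  convert this using 1
  ext v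
  simp

theorem definable_imp {L : FirstOrder.Language.{u, v}} {M : Type w} [L.Structure M]
    {A : Set M} {α : Type*} {P Q : (α → M) → Prop} (hP : A.Definable L {w | P w})
    (hQ : A.Definable L {w | Q w}) : A.Definable L {w | P w → Q w} := by
  convert hP.himp hQ using 1
  ext v
  simp [himp_eq, imp_iff_or_not]

theorem definable_iff {L : FirstOrder.Language.{u, v}} {M : Type w} [L.Structure M]
    {A : Set M} {α : Type*} {P Q : (α → M) → Prop} (hP : A.Definable L {w | P w})
    (hQ : A.Definable L {w | Q w}) : A.Definable L {w | P w ↔ Q w} := by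
  simpa only [iff_iff_implies_and_implies] using!
    (definable_imp hP hQ).inter (definable_imp hQ hP)

theorem definableFun_zero : (∅ : Set ℕ).DefinableFun arithLang fun _ : α → ℕ => 0 :=
  (Language.Term.func (L := arithLang) ArithFunc.zero Fin.elim0).definableFun_realize

theorem definableFun_one : (∅ : Set ℕ).DefinableFun arithLang fun _ : α → ℕ => 1 :=
  (Language.Term.func (L := arithLang) ArithFunc.one Fin.elim0).definableFun_realize

theorem definableFun_add (hf : (∅ : Set ℕ).DefinableFun arithLang f)
    (hg : (∅ : Set ℕ).DefinableFun arithLang g) :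
    (∅ : Set ℕ).DefinableFun arithLang fun v => f v + g v := by
  have hF : (∅ : Set ℕ).DefinableMap arithLang fun v => ![f v, g v] := by
    intro i
    fin_cases i
    exacts [hf, hg]
  exact (Set.DefinableFun.fun_symbol (L := arithLang) ArithFunc.add).comp hF

theorem definableFun_mul (hf : (∅ : Set ℕ).DefinableFun arithLang f)
    (hg : (∅ : Set ℕ).DefinableFun arithLang g) :
    (∅ : Set ℕ).DefinableFun arithLang fun v => f v * g v := by
  have hF : (∅ : Set ℕ).DefinableMap arithLang fun v => ![f v, g v] := by
    intro i
    fin_cases i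
    exacts [hf, hg]
  exact (Set.DefinableFun.fun_symbol (L := arithLang) ArithFunc.mul).comp hF

theorem definable_lt (hf : (∅ : Set ℕ).DefinableFun arithLang f)
    (hg : (∅ : Set ℕ).DefinableFun arithLang g) :
    (∅ : Set ℕ).Definable arithLang {v | f v < g v} := by
  have := definable_exists (P := fun w => f (w ∘ some) + w none + 1 = g (w ∘ some))
    ((definableFun_add (definableFun_add (definableFun_reindex hf some) (.proj _))
      definableFun_one).ofPred_eq (definableFun_reindex hg some))
  convert this using 1
  ext v
  change f v < g v ↔ ∃ y, f v + y + 1 = g v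
  exact ⟨fun h => ⟨g v - f v - 1, by omega⟩, fun ⟨y, hy⟩ => by omega⟩

/-- The moduli of the β function are all successors, so the conventional value of a remainder modulo
0 never has to be described. -/
theorem definableFun_mod (hf : (∅ : Set ℕ).DefinableFun arithLang f)
    (hg : (∅ : Set ℕ).DefinableFun arithLang g) :
    (∅ : Set ℕ).DefinableFun arithLang fun v => f v % (g v + 1) := by
  have h1 := definable_exists
    (P := fun w : Option (Option α) → ℕ =>
      f (w ∘ (some ∘ some)) = (g (w ∘ (some ∘ some)) + 1) * w none + w (some none))
    ((definableFun_reindex hf _).ofPred_eq (definableFun_add (definableFun_mul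
      (definableFun_add (definableFun_reindex hg _) definableFun_one) (.proj _)) (.proj _)))
  have h2 : (∅ : Set ℕ).Definable arithLang
      {w : Option α → ℕ | w none < g (w ∘ some) + 1} :=
    definable_lt (.proj _)
      (definableFun_add (definableFun_reindex hg _) definableFun_one)
  unfold Set.DefinableFun
  convert h1.inter h2 using 1
  ext w
  simp only [Function.tupleGraph, mem_ofPred_eq, mem_inter_iff, Function.comp_def, Option.elim]
  constructor
  · intro h
    rw [← h]
    exact ⟨⟨_, (Nat.div_add_mod _ _).symm⟩, Nat.mod_lt _ (Nat.succ_pos _)⟩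
  · rintro ⟨⟨q, hq⟩, hlt⟩
    rw [hq, Nat.mul_add_mod, Nat.mod_eq_of_lt hlt]

/-- Gödel's β function: the history of a recursion is a finite sequence, coded by two numbers c and
b whose remainders `c % ((i + 1) * b + 1)` are its terms. Recursion thus becomes a first-order
condition. -/
theorem eq_natRec_iff (a : ℕ) (h : ℕ → ℕ → ℕ) (x z : ℕ) :
    z = Nat.rec (motive := fun _ => ℕ) a h x ↔
      ∃ c b, c % (b + 1) = a ∧
        (∀ i, i < x → c % ((i + 1 + 1) * b + 1) = h i (c % ((i + 1) * b + 1))) ∧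
        z = c % ((x + 1) * b + 1) := by
  constructor
  · rintro rfl
    set r : ℕ → ℕ := fun i => Nat.rec (motive := fun _ => ℕ) a h i
    set l := List.ofFn fun i : Fin (x + 1) => r i with hl
    have hb (i : ℕ) (hi : i ≤ x) : Nat.beta (Nat.unbeta l) i = r i := by
      have := Nat.beta_unbeta_coe l ⟨i, by simp [hl]; omega⟩
      rwa [Fin.getElem_fin, List.getElem_ofFn] at this
    refine ⟨(Nat.unbeta l).unpair.1, (Nat.unbeta l).unpair.2, ?_, fun i hi => ?_, ?_⟩
    · have := hb 0 (Nat.zero_le _)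
      rwa [Nat.beta, zero_add, one_mul] at this
    · have h1 := hb (i + 1) hi
      have h2 := hb i hi.le
      unfold Nat.beta at h1 h2
      rw [h1, h2]
    · exact (hb x le_rfl).symm
  · rintro ⟨c, b, h0, hs, rfl⟩
    have : ∀ i, i ≤ x → c % ((i + 1) * b + 1) = Nat.rec (motive := fun _ => ℕ) a h i := by
      intro i
      induction i with
      | zero => intro _; simpa using h0
      | succ i ih => intro hi; rw [hs i hi, ih (by omega)]
    exact this x le_rfl

theorem definableFun_natRec [Finite α] {f : (α → ℕ) → ℕ} {g : (Option (Option α) → ℕ) → ℕ}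
    (hf : (∅ : Set ℕ).DefinableFun arithLang f) (hg : (∅ : Set ℕ).DefinableFun arithLang g) :
    (∅ : Set ℕ).DefinableFun arithLang fun v : Option α → ℕ =>
      Nat.rec (motive := fun _ => ℕ) (f (v ∘ some))
        (fun i y => g fun o => o.elim y fun o => o.elim i (v ∘ some)) (v none) := by
  unfold Set.DefinableFun
  have hproj {β : Type} (i : β) : (∅ : Set ℕ).DefinableFun arithLang fun v : β → ℕ => v i :=
    .proj _
  have hmod {β : Type} (c b : β) {k : (β → ℕ) → ℕ} (hk : (∅ : Set ℕ).DefinableFun arithLang k) :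
      (∅ : Set ℕ).DefinableFun arithLang fun w : β → ℕ => w c % ((k w + 1) * w b + 1) :=
    definableFun_mod (hproj c) (definableFun_mul (definableFun_add hk definableFun_one) (hproj b))
  -- Order of the variables: b, c, the value, the recursion argument, the parameters. In `hG` and
  -- `h2` the index i is put in front of them.
  have h1 : (∅ : Set ℕ).Definable arithLang {w : Option (Option (Option (Option α))) → ℕ |
      w (some none) % (w none + 1) = f (w ∘ (some ∘ some ∘ some ∘ some))} :=
    (definableFun_mod (hproj _) (hproj _)).ofPred_eq (definableFun_reindex hf _)
  have h3 : (∅ : Set ℕ).Definable arithLang {w : Option (Option (Option (Option α))) → ℕ |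
      w (some (some none)) = w (some none) % ((w (some (some (some none))) + 1) * w none + 1)} :=
    (hproj _).ofPred_eq (hmod _ _ (hproj _))
  have hG : (∅ : Set ℕ).DefinableFun arithLang
      fun w : Option (Option (Option (Option (Option α)))) → ℕ =>
        g fun o => o.elim (w (some (some none)) % ((w none + 1) * w (some none) + 1))
          fun o => o.elim (w none) (w ∘ (some ∘ some ∘ some ∘ some ∘ some)) := by
    refine hg.comp ?_
    rintro (_ | _ | i)
    exacts [hmod _ _ (hproj _), hproj _, hproj _]
  have h2 := definable_forall (P := fun w : Option (Option (Option (Option (Option α)))) → ℕ =>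
      w none < w (some (some (some (some none)))) →
        w (some (some none)) % ((w none + 1 + 1) * w (some none) + 1) =
        g fun o => o.elim (w (some (some none)) % ((w none + 1) * w (some none) + 1))
          fun o => o.elim (w none) (w ∘ (some ∘ some ∘ some ∘ some ∘ some)))
    (definable_imp (definable_lt (hproj _) (hproj _))
      ((hmod _ _ (definableFun_add (hproj _) definableFun_one)).ofPred_eq hG))
  convert definable_exists (definable_exists ((h1.inter h2).inter h3)) using 1
  ext w
  rw [Function.tupleGraph, mem_ofPred_eq, eq_comm, eq_natRec_iff]
  exact ⟨fun ⟨c, b, h0, hs, h⟩ => ⟨c, b, ⟨h0, hs⟩, h⟩, fun ⟨c, b, ⟨h0, hs⟩, h⟩ => ⟨c, b, h0, hs, h⟩⟩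

theorem definableFun_of_primrec' {n : ℕ} {f : List.Vector ℕ n → ℕ} (hf : Nat.Primrec' f) :
    (∅ : Set ℕ).DefinableFun arithLang fun v : Fin n → ℕ => f (List.Vector.ofFn v) := by
  induction hf with
  | zero => exact definableFun_zero
  | succ =>
    refine (definableFun_add (Set.DefinableFun.proj _ (i := 0)) definableFun_one)
  | get i =>
    simp only [List.Vector.get_ofFn]
    exact .proj _
  | comp g _ _ hf hg => exact hf.comp hg
  | @prec n f g _ _ hf hg =>
    -- `Nat.Primrec'.prec` lists the counter before the previous value, whereas in
    -- `definableFun_natRec` the previous value comes first; the reindexing swaps them.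
    have h := definableFun_natRec hf (definableFun_reindex hg
      (Fin.cons (some none) (Fin.cons none (fun i => some (some i)))))
    convert definableFun_reindex h (fun o => o.elim 0 Fin.succ : Option (Fin n) → Fin (n + 1))
      using 1
    funext v
    simp only [List.Vector.ofFn, List.Vector.head_cons, List.Vector.tail_cons]
    rfl

variable {L : FirstOrder.Language.{u, v}} [L.Structure ℕ]

theorem exists_formula_of_primrec (ι : arithLang →ᴸ L) [ι.IsExpansionOn ℕ] {n : ℕ}
    {R : Set (Fin n → ℕ)} {f : List.Vector ℕ n → ℕ} (hf : Primrec f)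
    (hR : ∀ a, a ∈ R ↔ f (List.Vector.ofFn a) = 0) :
    ∃ φ : L.Formula (Fin n), ∀ a : Fin n → ℕ, φ.Realize a ↔ a ∈ R := by
  have h : (∅ : Set ℕ).Definable arithLang R := by
    convert (definableFun_of_primrec' (Nat.Primrec'.of_prim hf)).ofPred_eq definableFun_zero
      using 1
    ext a
    exact hR a
  obtain ⟨φ, hφ⟩ := Set.empty_definable_iff.1 (h.map_expansion ι)
  exact ⟨φ, fun a => by rw [hφ]; rfl⟩

/-! ### Binary digits and cardinalities of coded sets are primitive recursive -/

theorem testBit_eq_bodd (n k : ℕ) : n.testBit k = (n / 2 ^ k).bodd := by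
  rw [Nat.testBit_eq_decide_div_mod_eq, Nat.mod_two_of_bodd]
  cases (n / 2 ^ k).bodd <;> rfl

theorem primrec_two_pow : Primrec fun k : ℕ => 2 ^ k := by
  have : Primrec fun k : ℕ => (Nat.rec 1 (fun _ y => 2 * y) k : ℕ) :=
    Primrec.nat_rec₁ 1 (Primrec.nat_mul.comp (Primrec.const 2) Primrec.snd)
  refine this.of_eq fun k => ?_
  induction k with
  | zero => rfl
  | succ k ih => rw [pow_succ, ← ih, mul_comm]

theorem primrec_testBit : Primrec₂ Nat.testBit :=
  (Primrec.nat_bodd.comp (Primrec.nat_div.comp Primrec.fst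
    (primrec_two_pow.comp Primrec.snd))).of_eq fun x => (testBit_eq_bodd x.1 x.2).symm

/-- The number of binary digits `1` of `n`, i.e. the cardinality of the set coded by `n`. -/
theorem length_bitIndices (n : ℕ) :
    n.bitIndices.length = ((List.range n).filter fun i => n.testBit i).length := by
  rw [← List.toFinset_card_of_nodup Nat.bitIndices_nodup,
    ← List.toFinset_card_of_nodup (List.nodup_range.filter _)]
  congr 1
  ext i
  simp only [List.mem_toFinset, Nat.mem_bitIndices, List.mem_filter, List.mem_range,
    iff_and_self]
  exact fun h => (Nat.lt_two_pow_self).trans_le (Nat.ge_two_pow_of_testBit h)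

theorem primrec_length_bitIndices : Primrec fun n : ℕ => n.bitIndices.length := by
  have : Primrec fun n : ℕ => (Nat.rec 0
      (fun i y => y + (n.testBit i).toNat) n : ℕ) := by
    refine Primrec.nat_rec' (h := fun n q => q.2 + (n.testBit q.1).toNat)
      Primrec.id (Primrec.const 0) ?_
    refine Primrec.nat_add.comp (Primrec.snd.comp Primrec.snd) ?_
    exact (Primrec.dom_bool Bool.toNat).comp
      (primrec_testBit.comp Primrec.fst (Primrec.fst.comp Primrec.snd))
  refine this.of_eq fun n => ?_
  rw [length_bitIndices]
  have (k : ℕ) : (Nat.rec 0 (fun i y => y + (n.testBit i).toNat) k : ℕ) =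
      ((List.range k).filter fun i => n.testBit i).length := by
    induction k with
    | zero => rfl
    | succ k ih =>
      rw [List.range_succ, List.filter_append, List.length_append, ← ih]
      cases h : n.testBit k <;> simp [h]
  exact this n

theorem exists_formula_testBit (ι : arithLang →ᴸ L) [ι.IsExpansionOn ℕ] :
    ∃ φ : L.Formula (Fin 2), ∀ a : Fin 2 → ℕ,
      φ.Realize a ↔ a ∈ {a : Fin 2 → ℕ | (a 1).testBit (a 0) = true} := by
  refine exists_formula_of_primrec ι (f := fun v => (!(v.get 1).testBit (v.get 0)).toNat) ?_ ?_
  · exact (Primrec.dom_bool fun b => (!b).toNat).comp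
      (primrec_testBit.comp (Primrec.vector_get.comp .id (.const 1))
        (Primrec.vector_get.comp .id (.const 0)))
  · simp

theorem exists_formula_mul_card_le (ι : arithLang →ᴸ L) [ι.IsExpansionOn ℕ] (k l : ℕ) :
    ∃ φ : L.Formula (Fin 2), ∀ a : Fin 2 → ℕ, φ.Realize a ↔
      a ∈ {a : Fin 2 → ℕ | k * (a 0).bitIndices.length ≤ l * (a 1).bitIndices.length} := by
  -- With truncated subtraction, a ≤ b says that a - b = 0.
  refine exists_formula_of_primrec ι
    (f := fun v => k * (v.get 0).bitIndices.length - l * (v.get 1).bitIndices.length) ?_ ?_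
  · exact Primrec.nat_sub.comp
      (Primrec.nat_mul.comp (.const k) (primrec_length_bitIndices.comp
        (Primrec.vector_get.comp .id (.const 0))))
      (Primrec.nat_mul.comp (.const l) (primrec_length_bitIndices.comp
        (Primrec.vector_get.comp .id (.const 1))))
  · simp [Nat.sub_eq_zero_iff_le]

end Arithmetic

/-! ### Transfer of statements from ℕ to M -/

section Transfer

variable {L : FirstOrder.Language.{u, v}} {M : Type w} [L.Structure M]

theorem sumElim_comp_optionElim {α X : Type*} (v : α → X) (u : Fin 1 → X) :
    (Sum.elim v u ∘ fun o : Option α => o.elim (Sum.inr 0) Sum.inl) = fun o => o.elim (u 0) v := by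
  funext o
  cases o <;> rfl

theorem comp_vecCons₂ {α X : Type*} (v : α → X) (i j : α) : v ∘ ![i, j] = ![v i, v j] := by
  funext k
  fin_cases k <;> rfl

/-- The truth of `φ` at all tuples is expressed by one sentence, also if `φ` is a formula in
infinitely many variables. -/
theorem realize_of_elementarilyEquivalent {N : Type*} [L.Structure N] [Nonempty N]
    (hN : L.ElementarilyEquivalent N M) {α : Type*} {φ : L.Formula α} (h : ∀ v : α → N, φ.Realize v)
    (v : α → M) : φ.Realize v := by
  classical
  let ψ : L.Formula φ.freeVarFinset := φ.restrictFreeVar id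
  have hψN (v : α → N) : ψ.Realize (fun a => v a) ↔ φ.Realize v :=
    Language.BoundedFormula.realize_restrictFreeVar _ fun _ => rfl
  have hψM : ψ.Realize (fun a => v a) ↔ φ.Realize v :=
    Language.BoundedFormula.realize_restrictFreeVar _ fun _ => rfl
  have hs := hN.realize_sentence
    ((ψ.relabel Sum.inr : L.Formula (Empty ⊕ φ.freeVarFinset)).iAlls φ.freeVarFinset)
  simp only [Language.Sentence.Realize, Language.Formula.realize_iAlls,
    Language.Formula.realize_relabel, Function.comp_def, Sum.elim_inr] at hs
  refine hψM.1 (hs.1 (fun y => ?_) _)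
  -- An assignment to the finitely many free variables extends arbitrarily to all variables.
  obtain ⟨v', rfl⟩ : ∃ v' : α → N, (fun a : φ.freeVarFinset => v' a) = y :=
    ⟨fun a => if h : a ∈ φ.freeVarFinset then y ⟨a, h⟩ else Classical.arbitrary N, by simp⟩
  exact (hψN v').2 (h v')

variable [L.Structure ℕ]

variable (L) in
/-- One formula of `L` defines `P` in `ℕ` and `Q` in `M`. -/
def Transfers {α : Type*} (P : (α → ℕ) → Prop) (Q : (α → M) → Prop) : Prop :=
  ∃ φ : L.Formula α, (∀ v, φ.Realize v ↔ P v) ∧ ∀ v, φ.Realize v ↔ Q v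

namespace Transfers

variable {α β : Type*} {P P' : (α → ℕ) → Prop} {Q Q' : (α → M) → Prop}

theorem not (h : Transfers L P Q) : Transfers L (fun v => ¬ P v) (fun v => ¬ Q v) := by
  obtain ⟨φ, h1, h2⟩ := h
  exact ⟨φ.not, fun v => by simp [h1], fun v => by simp [h2]⟩

theorem and (h : Transfers L P Q) (h' : Transfers L P' Q') :
    Transfers L (fun v => P v ∧ P' v) (fun v => Q v ∧ Q' v) := by
  obtain ⟨φ, h1, h2⟩ := h
  obtain ⟨φ', h1', h2'⟩ := h'
  exact ⟨φ ⊓ φ', fun v => by simp [h1, h1'], fun v => by simp [h2, h2']⟩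

theorem or (h : Transfers L P Q) (h' : Transfers L P' Q') :
    Transfers L (fun v => P v ∨ P' v) (fun v => Q v ∨ Q' v) := by
  obtain ⟨φ, h1, h2⟩ := h
  obtain ⟨φ', h1', h2'⟩ := h'
  exact ⟨φ ⊔ φ', fun v => by simp [h1, h1'], fun v => by simp [h2, h2']⟩

theorem imp (h : Transfers L P Q) (h' : Transfers L P' Q') :
    Transfers L (fun v => P v → P' v) (fun v => Q v → Q' v) := by
  obtain ⟨φ, h1, h2⟩ := h
  obtain ⟨φ', h1', h2'⟩ := h'
  exact ⟨φ.imp φ', fun v => by simp [h1, h1'], fun v => by simp [h2, h2']⟩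

theorem iff (h : Transfers L P Q) (h' : Transfers L P' Q') :
    Transfers L (fun v => P v ↔ P' v) (fun v => Q v ↔ Q' v) := by
  obtain ⟨φ, h1, h2⟩ := h
  obtain ⟨φ', h1', h2'⟩ := h'
  exact ⟨φ.iff φ', fun v => by simp [h1, h1'], fun v => by simp [h2, h2']⟩

/-- Allows a conclusion about standard numbers, which does not mention the structure, to be drawn by
transfer. -/
theorem const (p : Prop) : Transfers L (fun _ : α → ℕ => p) (fun _ : α → M => p) := by
  by_cases hp : p
  · exact ⟨⊤, fun v => by simp [hp], fun v => by simp [hp]⟩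
  · exact ⟨⊥, fun v => by simp [hp], fun v => by simp [hp]⟩

theorem eq (i j : α) : Transfers L (fun v => v i = v j) (fun v : α → M => v i = v j) :=
  ⟨(Language.Term.var i).equal (Language.Term.var j), fun v => by simp, fun v => by simp⟩

theorem reindex (e : α → β) (h : Transfers L P Q) :
    Transfers L (fun v : β → ℕ => P (v ∘ e)) (fun v => Q (v ∘ e)) := by
  obtain ⟨φ, h1, h2⟩ := h
  exact ⟨φ.relabel e, fun v => by simp [h1], fun v => by simp [h2]⟩

theorem all {P : (Option α → ℕ) → Prop} {Q : (Option α → M) → Prop} (h : Transfers L P Q) :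
    Transfers L (fun v : α → ℕ => ∀ y, P fun o => o.elim y v)
      (fun v => ∀ y, Q fun o => o.elim y v) := by
  obtain ⟨φ, h1, h2⟩ := h
  refine ⟨(φ.relabel fun o => o.elim (Sum.inr 0) Sum.inl : L.Formula (α ⊕ Fin 1)).iAlls (Fin 1),
    fun v => ?_, fun v => ?_⟩
  · simp only [Language.Formula.realize_iAlls, Language.Formula.realize_relabel,
      sumElim_comp_optionElim, h1]
    exact ⟨fun h y => h fun _ => y, fun h u => h (u 0)⟩
  · simp only [Language.Formula.realize_iAlls, Language.Formula.realize_relabel,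
      sumElim_comp_optionElim, h2]
    exact ⟨fun h y => h fun _ => y, fun h u => h (u 0)⟩

theorem ex {P : (Option α → ℕ) → Prop} {Q : (Option α → M) → Prop} (h : Transfers L P Q) :
    Transfers L (fun v : α → ℕ => ∃ y, P fun o => o.elim y v)
      (fun v => ∃ y, Q fun o => o.elim y v) := by
  simpa using h.not.all.not

/-- Together with the closure properties above, this turns elementary facts about finite sets of
natural numbers into facts about M. -/
theorem forall_of_forall (hM : L.ElementarilyEquivalent ℕ M) (h : Transfers L P Q)
    (hP : ∀ v, P v) (v : α → M) : Q v := by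
  obtain ⟨φ, h1, h2⟩ := h
  exact (h2 v).1 (realize_of_elementarilyEquivalent hM (fun v => (h1 v).2 (hP v)) v)

theorem star (hM : L.ElementarilyEquivalent ℕ M) {R : Set (Fin 2 → ℕ)}
    (hR : ∃ φ : L.Formula (Fin 2), ∀ a : Fin 2 → ℕ, φ.Realize a ↔ a ∈ R) (i j : α) :
    Transfers L (fun v : α → ℕ => ![v i, v j] ∈ R)
      (fun v : α → M => ![v i, v j] ∈ star L R) := by
  obtain ⟨φ, hφ⟩ := hR
  refine ⟨φ.relabel ![i, j], fun v => ?_, fun v => ?_⟩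
  · rw [Language.Formula.realize_relabel, hφ, comp_vecCons₂]
  · rw [Language.Formula.realize_relabel, comp_vecCons₂]
    exact (mem_star_iff L hM φ hφ _).symm

end Transfers

/-! ### Coded sets and comparison of their cardinalities in M -/

variable (L) in
/-- `k · |s| ≤ l · |t|` in `M`, for standard `k` and `l`. -/
def CardLE (k l : ℕ) (s t : M) : Prop :=
  ![s, t] ∈ (star L {a : Fin 2 → ℕ |
    k * (a 0).bitIndices.length ≤ l * (a 1).bitIndices.length} : Set (Fin 2 → M))

theorem mulCardLE_iff (k : ℕ) (s t : M) : MulCardLE L k s t ↔ CardLE L k 1 s t := by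
  simp [MulCardLE, CardLE]

/-- The finite set coded by a natural number. -/
def bits (n : ℕ) : Finset ℕ := n.bitIndices.toFinset

theorem mem_bits {x n : ℕ} : x ∈ bits n ↔ n.testBit x = true := by
  simp [bits]

theorem card_bits (n : ℕ) : (bits n).card = n.bitIndices.length :=
  List.toFinset_card_of_nodup Nat.bitIndices_nodup

theorem exists_bits_eq (s : Finset ℕ) : ∃ n, bits n = s :=
  ⟨∑ i ∈ s, 2 ^ i, Finset.toFinset_bitIndices_sum_two_pow s⟩

variable {α : Type*}

theorem transfers_mem (ι : arithLang →ᴸ L) [ι.IsExpansionOn ℕ]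
    (hM : L.ElementarilyEquivalent ℕ M) (i j : α) :
    Transfers L (fun v : α → ℕ => v i ∈ bits (v j)) (fun v : α → M => Mem L (v i) (v j)) := by
  have := Transfers.star (M := M) hM (exists_formula_testBit ι) i j
  simpa only [mem_bits] using! this

theorem transfers_cardLE (ι : arithLang →ᴸ L) [ι.IsExpansionOn ℕ]
    (hM : L.ElementarilyEquivalent ℕ M) (k l : ℕ) (i j : α) :
    Transfers L (fun v : α → ℕ => k * (bits (v i)).card ≤ l * (bits (v j)).card)
      (fun v : α → M => CardLE L k l (v i) (v j)) := by
  have := Transfers.star (M := M) hM (exists_formula_mul_card_le ι k l) i j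
  simpa only [card_bits] using! this

/-- In ℕ every subset of a finite set has a code. Turning the parameters of the defining formula
into universally quantified variables makes this a transferable statement. -/
theorem exists_separation (ι : arithLang →ᴸ L) [ι.IsExpansionOn ℕ]
    (hM : L.ElementarilyEquivalent ℕ M) {D : Set M} (hD : (Set.univ : Set M).Definable₁ L D) (w : M) :
    ∃ s : M, ∀ x, Mem L x s ↔ Mem L x w ∧ x ∈ D := by
  obtain ⟨φ, hφ⟩ := Set.definable_iff_exists_formula_sum.1 hD
  have hφ' (x : M) : φ.Realize (Sum.elim (↑) fun _ => x) ↔ x ∈ D :=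
    (Set.ext_iff.1 hφ fun _ => x).symm
  have h1 : Transfers L φ.Realize (φ.Realize : ((Set.univ : Set M) ⊕ Fin 1 → M) → Prop) :=
    ⟨φ, fun _ => Iff.rfl, fun _ => Iff.rfl⟩
  have h2 := h1.reindex (β := Option (Option (Option (Set.univ : Set M))))
    (Sum.elim (fun m => some (some (some m))) fun _ => none)
  have h3 := (transfers_mem ι hM none (some none)).iff
    ((transfers_mem ι hM none (some (some none))).and h2)
  obtain ⟨s, hs⟩ := h3.all.ex.forall_of_forall hM (fun v => by
    classical
    obtain ⟨n, hn⟩ := exists_bits_eq ((bits (v none)).filter fun x =>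
      φ.Realize (Sum.elim (fun m => v (some m)) fun _ => x))
    refine ⟨n, fun x => ?_⟩
    change x ∈ bits n ↔ x ∈ bits (v none) ∧ _
    rw [hn, Finset.mem_filter]
    refine and_congr_right fun _ => iff_of_eq (congrArg _ ?_)
    funext k
    rcases k with _ | _ <;> rfl) (fun o => o.elim w (↑))
  refine ⟨s, fun x => (hs x).trans (and_congr_right fun _ => ?_)⟩
  rw [← hφ']
  refine iff_of_eq (congrArg _ ?_)
  funext k
  rcases k with _ | _ <;> rfl

/-- A number is the sum of the powers of two given by its digits. So each set has at most one code,
and its size is well defined. -/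
theorem ext_of_mem (ι : arithLang →ᴸ L) [ι.IsExpansionOn ℕ]
    (hM : L.ElementarilyEquivalent ℕ M) {s t : M} (h : ∀ x, Mem L x s ↔ Mem L x t) : s = t := by
  refine (((transfers_mem ι hM none (some 0)).iff (transfers_mem ι hM none (some 1))).all.imp
    (Transfers.eq (0 : Fin 2) 1)).forall_of_forall hM (fun v hv => ?_) ![s, t] h
  have : bits (v 0) = bits (v 1) := Finset.ext hv
  exact by
    rw [← Finset.sum_toFinset_bitIndices_two_pow (v 0),
      ← Finset.sum_toFinset_bitIndices_two_pow (v 1)]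
    exact congrArg (fun s : Finset ℕ => ∑ i ∈ s, 2 ^ i) this

theorem cardLE_mono (ι : arithLang →ᴸ L) [ι.IsExpansionOn ℕ]
    (hM : L.ElementarilyEquivalent ℕ M) {k l : ℕ} {s t w : M} (hst : ∀ x, Mem L x s → Mem L x t)
    (h : CardLE L k l t w) : CardLE L k l s w := by
  refine (((transfers_mem ι hM none (some 0)).imp (transfers_mem ι hM none (some 1))).all.imp
    ((transfers_cardLE ι hM k l (1 : Fin 3) 2).imp (transfers_cardLE ι hM k l 0 2))).forall_of_forall
    hM (fun v hv hc => ?_) ![s, t, w] hst h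
  exact (Nat.mul_le_mul_left k (Finset.card_le_card hv)).trans hc

theorem cardLE_total (ι : arithLang →ᴸ L) [ι.IsExpansionOn ℕ]
    (hM : L.ElementarilyEquivalent ℕ M) (k l : ℕ) (s w : M) : CardLE L k l s w ∨ CardLE L l k w s :=
  ((transfers_cardLE ι hM k l (0 : Fin 2) 1).or (transfers_cardLE ι hM l k 1 0)).forall_of_forall
    hM (fun _ => le_total _ _) ![s, w]

theorem cardLE_self (ι : arithLang →ᴸ L) [ι.IsExpansionOn ℕ]
    (hM : L.ElementarilyEquivalent ℕ M) (k : ℕ) (w : M) : CardLE L k k w w :=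
  (transfers_cardLE ι hM k k (0 : Fin 1) 0).forall_of_forall hM (fun _ => le_rfl) ![w]

/-- A lower bound l'/k' of |s|/|w| cannot exceed an upper bound l/k; nonemptiness of w allows |w| to
be cancelled. -/
theorem mul_le_mul_of_cardLE (ι : arithLang →ᴸ L) [ι.IsExpansionOn ℕ]
    (hM : L.ElementarilyEquivalent ℕ M) {k l k' l' : ℕ} {s w x : M} (hx : Mem L x w)
    (h : CardLE L k l s w) (h' : CardLE L l' k' w s) : l' * k ≤ l * k' := by
  refine (((transfers_mem ι hM (2 : Fin 3) 1).imp ((transfers_cardLE ι hM k l 0 1).imp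
    ((transfers_cardLE ι hM l' k' 1 0).imp (Transfers.const (l' * k ≤ l * k')))))).forall_of_forall
    hM (fun v hx h h' => ?_) ![s, w, x] hx h h'
  have hpos : 0 < (bits (v 1)).card := Finset.card_pos.2 ⟨_, hx⟩
  refine Nat.le_of_mul_le_mul_right ?_ hpos
  calc l' * k * (bits (v 1)).card = k * (l' * (bits (v 1)).card) := by ring
    _ ≤ k * (k' * (bits (v 0)).card) := Nat.mul_le_mul_left _ h'
    _ = k' * (k * (bits (v 0)).card) := by ring
    _ ≤ k' * (l * (bits (v 1)).card) := Nat.mul_le_mul_left _ h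
    _ = l * k' * (bits (v 1)).card := by ring

/-- Addition of the fractions l/k and l'/k' that bound |s|/|w| and |t|/|w| from above. -/
theorem cardLE_union (ι : arithLang →ᴸ L) [ι.IsExpansionOn ℕ]
    (hM : L.ElementarilyEquivalent ℕ M) {k l k' l' : ℕ} {s t r w : M}
    (hr : ∀ x, Mem L x r → Mem L x s ∨ Mem L x t) (hs : CardLE L k l s w)
    (ht : CardLE L k' l' t w) : CardLE L (k * k') (l * k' + l' * k) r w := by
  refine (((transfers_mem ι hM none (some 2)).imp ((transfers_mem ι hM none (some 0)).or
    (transfers_mem ι hM none (some 1)))).all.imp ((transfers_cardLE ι hM k l (0 : Fin 4) 3).imp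
      ((transfers_cardLE ι hM k' l' 1 3).imp
        (transfers_cardLE ι hM (k * k') (l * k' + l' * k) 2 3)))).forall_of_forall
    hM (fun v hr hs ht => ?_) ![s, t, r, w] hr hs ht
  have hc : (bits (v 2)).card ≤ (bits (v 0)).card + (bits (v 1)).card :=
    (Finset.card_le_card fun x hx => Finset.mem_union.2 (hr x hx)).trans
      (Finset.card_union_le _ _)
  calc k * k' * (bits (v 2)).card
      ≤ k * k' * ((bits (v 0)).card + (bits (v 1)).card) := Nat.mul_le_mul_left _ hc
    _ = k' * (k * (bits (v 0)).card) + k * (k' * (bits (v 1)).card) := by ring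
    _ ≤ k' * (l * (bits (v 3)).card) + k * (l' * (bits (v 3)).card) :=
      Nat.add_le_add (Nat.mul_le_mul_left _ hs) (Nat.mul_le_mul_left _ ht)
    _ = (l * k' + l' * k) * (bits (v 3)).card := by ring

theorem cardLE_disjoint_union (ι : arithLang →ᴸ L) [ι.IsExpansionOn ℕ]
    (hM : L.ElementarilyEquivalent ℕ M) {k l k' l' : ℕ} {s t r w : M}
    (hr : ∀ x, Mem L x s ∨ Mem L x t → Mem L x r) (hd : ∀ x, ¬ (Mem L x s ∧ Mem L x t))
    (hs : CardLE L l k w s) (ht : CardLE L l' k' w t) :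
    CardLE L (l * k' + l' * k) (k * k') w r := by
  refine ((((transfers_mem ι hM none (some 0)).or
    (transfers_mem ι hM none (some 1))).imp (transfers_mem ι hM none (some 2))).all.imp
    (((transfers_mem ι hM none (some 0)).and (transfers_mem ι hM none (some 1))).not.all.imp
      ((transfers_cardLE ι hM l k (3 : Fin 4) 0).imp
        ((transfers_cardLE ι hM l' k' 3 1).imp
          (transfers_cardLE ι hM (l * k' + l' * k) (k * k') 3 2))))).forall_of_forall
    hM (fun v hr hd hs ht => ?_) ![s, t, r, w] hr hd hs ht
  have hc : (bits (v 0)).card + (bits (v 1)).card ≤ (bits (v 2)).card := by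
    rw [← Finset.card_union_of_disjoint
      (Finset.disjoint_left.2 fun x hx hx' => hd x ⟨hx, hx'⟩)]
    exact Finset.card_le_card fun x hx => hr x (Finset.mem_union.1 hx)
  calc (l * k' + l' * k) * (bits (v 3)).card
      = k' * (l * (bits (v 3)).card) + k * (l' * (bits (v 3)).card) := by ring
    _ ≤ k' * (k * (bits (v 0)).card) + k * (k' * (bits (v 1)).card) :=
      Nat.add_le_add (Nat.mul_le_mul_left _ hs) (Nat.mul_le_mul_left _ ht)
    _ = k * k' * ((bits (v 0)).card + (bits (v 1)).card) := by ring
    _ ≤ k * k' * (bits (v 2)).card := Nat.mul_le_mul_left _ hc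

end Transfer

/-! ### Saturation for countable families of definable sets -/

section Saturation

variable {L : FirstOrder.Language.{u, v}} {M : Type w} [L.Structure M]

/-- Each definable set uses only finitely many parameters, so a countable family needs only a
countable parameter set. -/
theorem exists_forall_mem_of_saturated (hsat : Aleph1Saturated L M) {I : Type*} [Countable I]
    (D : I → Set M) (hD : ∀ i, (Set.univ : Set M).Definable₁ L (D i))
    (h : ∀ t : Finset I, ∃ m, ∀ i ∈ t, m ∈ D i) : ∃ m, ∀ i, m ∈ D i := by
  choose A0 _ hA0 using fun i => Set.definable_iff_finitely_definable.1 (hD i)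
  set C : Set M := ⋃ i, (A0 i : Set M)
  have hC : C.Countable := Set.countable_iUnion fun i => (A0 i).countable_toSet
  choose φ hφ using fun i => (hA0 i).mono (Set.subset_iUnion (fun i => (A0 i : Set M)) i)
  have hφ' (i : I) (m : M) : (φ i).Realize (fun _ => m) ↔ m ∈ D i :=
    (Set.ext_iff.1 (hφ i) fun _ => m).symm
  obtain ⟨m, hm⟩ := hsat C hC (Set.range φ) fun Φ hΦ => by
    classical
    rw [← Set.image_univ] at hΦ
    obtain ⟨t, -, rfl⟩ := Finset.subset_set_image_iff.1 hΦ
    obtain ⟨m, hm⟩ := h t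
    refine ⟨m, fun ψ hψ => ?_⟩
    obtain ⟨i, hi, rfl⟩ := Finset.mem_image.1 hψ
    exact (hφ' i m).2 (hm i hi)
  exact ⟨m, fun i => (hφ' i m).1 (hm _ ⟨i, rfl⟩)⟩

end Saturation

/-! ### Unions of directed families up to null sets -/

section DirectedApproximation

variable {A : Type*} [BooleanAlgebra A] {m : A → ℝ}

theorem measure_sdiff_le (hmono : Monotone m)
    (hadd : ∀ U V, Disjoint U V → m (U ⊔ V) = m U + m V) (U V W : A) :
    m (U \ W) ≤ m (U \ V) + m (V \ W) := by
  have h := hadd (U \ V) ((V \ W) \ (U \ V)) disjoint_sdiff_self_right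
  have h1 : m ((V \ W) \ (U \ V)) ≤ m (V \ W) := hmono sdiff_le
  have h2 : m (U \ W) ≤ m (U \ V ⊔ (V \ W) \ (U \ V)) := by
    refine hmono ?_
    rw [sup_sdiff_self_right]
    exact sdiff_triangle U V W
  linarith

/-- An upward directed family in a Boolean algebra with a finitely additive measure that satisfies
a weak form of `σ`-completeness has a union up to null sets, and this union is approximated in
measure by members of the family. -/
theorem exists_null_union (hmono : Monotone m)
    (hadd : ∀ U V, Disjoint U V → m (U ⊔ V) = m U + m V) (hbdd : ∀ U, m U ≤ 1)
    (hseq : ∀ U : ℕ → A, Monotone U → ∀ r, (∀ n, m (U n) ≤ r) → ∃ W, (∀ n, U n ≤ W) ∧ m W ≤ r)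
    {S : Set A} (hne : S.Nonempty) (hdir : DirectedOn (· ≤ ·) S) :
    ∃ W, (∀ U ∈ S, m (U \ W) = 0) ∧ ∀ ε > 0, ∃ U ∈ S, m (W \ U) < ε := by
  have hbot : m ⊥ = 0 := by simpa using hadd ⊥ ⊥ disjoint_bot_left
  have hnonneg (U : A) : 0 ≤ m U := hbot ▸ hmono bot_le
  have hsub {U V : A} (h : U ≤ V) : m (V \ U) = m V - m U := by
    have := hadd U (V \ U) disjoint_sdiff_self_right
    rw [sup_sdiff_cancel_right h] at this
    linarith
  have hB : BddAbove (m '' S) := ⟨1, by rintro _ ⟨U, -, rfl⟩; exact hbdd U⟩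
  set r := sSup (m '' S) with hr
  have hle {U : A} (hU : U ∈ S) : m U ≤ r := le_csSup hB ⟨U, hU, rfl⟩
  have hV (n : ℕ) : ∃ U ∈ S, r - 1 / ((n : ℝ) + 1) < m U := by
    obtain ⟨_, ⟨U, hU, rfl⟩, h⟩ := exists_lt_of_lt_csSup (hne.image m)
      (sub_lt_self r (Nat.one_div_pos_of_nat (α := ℝ) (n := n)))
    exact ⟨U, hU, h⟩
  choose V hVS hVr using hV
  choose! f hfS hf1 hf2 using hdir
  -- Directedness turns the almost optimal `V n` into an increasing sequence in S with the same
  -- lower bounds on the measures.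
  let U : ℕ → A := fun n => Nat.rec (V 0) (fun n W => f W (V (n + 1))) n
  have hUS (n : ℕ) : U n ∈ S := by
    induction n with
    | zero => exact hVS 0
    | succ n ih => exact hfS _ ih _ (hVS _)
  have hUmono : Monotone U := monotone_nat_of_le_succ fun n => hf1 _ (hUS n) _ (hVS _)
  have hVU (n : ℕ) : V n ≤ U n := by
    cases n with
    | zero => exact le_rfl
    | succ n => exact hf2 _ (hUS n) _ (hVS _)
  have hUr (n : ℕ) : r - 1 / ((n : ℝ) + 1) < m (U n) := (hVr n).trans_le (hmono (hVU n))
  obtain ⟨W, hUW, hWr⟩ := hseq U hUmono r fun n => hle (hUS n)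
  refine ⟨W, fun X hX => le_antisymm (le_of_forall_pos_lt_add fun ε hε => ?_) (hnonneg _),
    fun ε hε => ?_⟩
  · obtain ⟨n, hn⟩ := exists_nat_one_div_lt hε
    -- The part of X outside W lies in Y \ U n. Its measure is below 1/(n + 1), since m Y ≤ r and U
    -- n is almost optimal.
    obtain ⟨Y, hY, hXY, hUY⟩ : ∃ Y ∈ S, X ≤ Y ∧ U n ≤ Y :=
      ⟨_, hfS _ hX _ (hUS n), hf1 _ hX _ (hUS n), hf2 _ hX _ (hUS n)⟩
    have h1 : m (X \ W) ≤ m (Y \ U n) := hmono (sdiff_le_sdiff hXY (hUW n))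
    rw [hsub hUY] at h1
    linarith [hle hY, hUr n]
  · obtain ⟨n, hn⟩ := exists_nat_one_div_lt hε
    refine ⟨U n, hUS n, ?_⟩
    rw [hsub (hUW n)]
    linarith [hUr n]

end DirectedApproximation

/-! ### The standard part of the counting measure -/

section Density

variable {L : FirstOrder.Language.{u, v}} [L.Structure ℕ] {M : Type w} [L.Structure M] {Ω : M}

/-- `s` is a code of `U`. -/
def IsCode (U : Set (elts L Ω)) (s : M) : Prop :=
  ∀ x, x ∈ elts L s ↔ ∃ h : x ∈ elts L Ω, (⟨x, h⟩ : elts L Ω) ∈ U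

/-- The standard part of `|U| / |Ω|`. -/
noncomputable def density (U : Set (elts L Ω)) : ℝ :=
  sInf {x | ∃ s, IsCode U s ∧ ∃ p q : ℕ, 0 < p ∧ CardLE L p q s Ω ∧ x = q / p}

theorem density_nonneg (U : Set (elts L Ω)) : 0 ≤ density U := by
  refine Real.sInf_nonneg ?_
  rintro _ ⟨s, -, p, q, -, -, rfl⟩
  positivity

theorem IsCode.mem_of_mem {U : Set (elts L Ω)} {s : M} (h : IsCode U s) {x : M}
    (hx : Mem L x s) : Mem L x Ω :=
  ((h x).1 hx).1

theorem exists_isCode (ι : arithLang →ᴸ L) [ι.IsExpansionOn ℕ]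
    (hM : L.ElementarilyEquivalent ℕ M) (U : definableSubsets L Ω) :
    ∃ s, IsCode (U : Set (elts L Ω)) s := by
  obtain ⟨D, hD, hU⟩ := U.2
  obtain ⟨s, hs⟩ := exists_separation ι hM hD Ω
  refine ⟨s, fun x => (hs x).trans ?_⟩
  rw [hU]
  exact ⟨fun ⟨h1, h2⟩ => ⟨h1, h2⟩, fun ⟨h1, h2⟩ => ⟨h1, h2⟩⟩

section

variable {U V : Set (elts L Ω)} {s t : M}

theorem density_mul_le (hs : IsCode U s) {p q : ℕ} (h : CardLE L p q s Ω) :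
    p * density U ≤ q := by
  rcases p.eq_zero_or_pos with rfl | hp
  · simp
  · have hp' : (0 : ℝ) < p := Nat.cast_pos.2 hp
    have : density U ≤ q / p := by
      refine csInf_le ⟨0, ?_⟩ ⟨s, hs, p, q, hp, h, rfl⟩
      rintro _ ⟨s, -, p, q, -, -, rfl⟩
      positivity
    rwa [le_div_iff₀' hp'] at this

theorem cardLE_one (ι : arithLang →ᴸ L) [ι.IsExpansionOn ℕ]
    (hM : L.ElementarilyEquivalent ℕ M) (hs : IsCode U s) : CardLE L 1 1 s Ω :=
  cardLE_mono ι hM (fun _ hx => hs.mem_of_mem hx) (cardLE_self ι hM 1 Ω)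

theorem density_le_one (ι : arithLang →ᴸ L) [ι.IsExpansionOn ℕ]
    (hM : L.ElementarilyEquivalent ℕ M) (hs : IsCode U s) : density U ≤ 1 := by
  simpa using density_mul_le hs (cardLE_one ι hM hs)

/-- The comparison inside M puts the lower bound q/p below every fraction in the infimum; by
uniqueness of codes, all these fractions concern the same s. -/
theorem le_density_mul (ι : arithLang →ᴸ L) [ι.IsExpansionOn ℕ]
    (hM : L.ElementarilyEquivalent ℕ M) (hΩ : (elts L Ω).Nonempty)
    (hs : IsCode U s) {p q : ℕ} (h : CardLE L q p Ω s) : (q : ℝ) ≤ p * density U := by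
  obtain ⟨x, hx⟩ := hΩ
  rcases p.eq_zero_or_pos with rfl | hp
  · have := mul_le_mul_of_cardLE ι hM hx (cardLE_one ι hM hs) h
    simpa using this
  · have hp' : (0 : ℝ) < p := Nat.cast_pos.2 hp
    rw [← div_le_iff₀' hp']
    refine le_csInf ⟨_, s, hs, 1, 1, one_pos, cardLE_one ι hM hs, rfl⟩ ?_
    rintro _ ⟨s', hs', p', q', hp2, h', rfl⟩
    obtain rfl : s' = s := ext_of_mem ι hM fun x => (hs' x).trans (hs x).symm
    have := mul_le_mul_of_cardLE ι hM hx h' h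
    rw [div_le_div_iff₀ hp' (Nat.cast_pos.2 hp2)]
    exact_mod_cast this

/-- Sizes in M are linearly ordered, so failure of the comparison gives the reverse one. The
inequality has to be strict because the standard part forgets infinitesimals. -/
theorem cardLE_of_density_lt (ι : arithLang →ᴸ L) [ι.IsExpansionOn ℕ]
    (hM : L.ElementarilyEquivalent ℕ M) (hΩ : (elts L Ω).Nonempty)
    (hs : IsCode U s) {p q : ℕ} (h : p * density U < q) : CardLE L p q s Ω :=
  (cardLE_total ι hM p q s Ω).resolve_right fun h' =>
    h.not_ge (le_density_mul ι hM hΩ hs h')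

theorem cardLE_of_lt_density (ι : arithLang →ᴸ L) [ι.IsExpansionOn ℕ]
    (hM : L.ElementarilyEquivalent ℕ M) (hs : IsCode U s) {p q : ℕ}
    (h : q < p * density U) : CardLE L q p Ω s :=
  (cardLE_total ι hM p q s Ω).resolve_left fun h' => h.not_ge (density_mul_le hs h')

theorem isInfinitesimal_iff (ι : arithLang →ᴸ L) [ι.IsExpansionOn ℕ]
    (hM : L.ElementarilyEquivalent ℕ M) (hΩ : (elts L Ω).Nonempty)
    (hs : IsCode U s) : IsInfinitesimal L Ω U ↔ density U = 0 := by
  constructor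
  · rintro ⟨s', hs', h⟩
    refine le_antisymm (le_of_forall_pos_lt_add fun ε hε => ?_) (density_nonneg U)
    obtain ⟨n, hn⟩ := exists_nat_one_div_lt hε
    have := density_mul_le hs' ((mulCardLE_iff _ _ _).1 (h (n + 1)))
    have h2 : density U ≤ 1 / ((n : ℝ) + 1) := by
      rw [le_div_iff₀' (by positivity)]
      exact_mod_cast this
    linarith
  · intro h
    exact ⟨s, hs, fun k => (mulCardLE_iff _ _ _).2
      (cardLE_of_density_lt ι hM hΩ hs (by simp [h]))⟩

theorem exists_nat_ratio_btwn {x y : ℝ} (hx : 0 ≤ x) (h : x < y) :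
    ∃ p q : ℕ, 0 < p ∧ x < (q : ℝ) / p ∧ (q : ℝ) / p < y := by
  obtain ⟨a, ha1, ha2⟩ := exists_rat_btwn h
  have ha : 0 ≤ a := by exact_mod_cast hx.trans ha1.le
  have hn : (a.num.toNat : ℝ) = a.num := by
    exact_mod_cast Int.toNat_of_nonneg (Rat.num_nonneg.2 ha)
  have : ((a.num.toNat : ℝ)) / a.den = a := by
    rw [hn]
    exact_mod_cast Rat.num_div_den a
  exact ⟨a.den, a.num.toNat, a.den_pos, by rwa [this], by rwa [this]⟩

theorem density_mono (ι : arithLang →ᴸ L) [ι.IsExpansionOn ℕ]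
    (hM : L.ElementarilyEquivalent ℕ M) (hΩ : (elts L Ω).Nonempty)
    (hs : IsCode U s) (ht : IsCode V t) (h : U ⊆ V) : density U ≤ density V := by
  by_contra! hlt
  obtain ⟨p, q, hp, h1, h2⟩ := exists_nat_ratio_btwn (density_nonneg V) hlt
  have hp' : (0 : ℝ) < p := Nat.cast_pos.2 hp
  rw [lt_div_iff₀' hp'] at h1
  rw [div_lt_iff₀' hp'] at h2
  refine h2.not_ge (density_mul_le hs (cardLE_mono ι hM (fun x hx => ?_)
    (cardLE_of_density_lt ι hM hΩ ht h1)))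
  obtain ⟨hx, hU⟩ := (hs x).1 hx
  exact (ht x).2 ⟨hx, h hU⟩

theorem density_union_le (ι : arithLang →ᴸ L) [ι.IsExpansionOn ℕ]
    (hM : L.ElementarilyEquivalent ℕ M) (hΩ : (elts L Ω).Nonempty)
    {r : M} (hs : IsCode U s) (ht : IsCode V t) (hr : IsCode (U ∪ V) r) :
    density (U ∪ V) ≤ density U + density V := by
  by_contra! hlt
  -- With half the gap for each summand, the sum of the two rational upper bounds stays below the
  -- density of the union.
  set δ := (density (U ∪ V) - (density U + density V)) / 2 with hδ
  have hδ0 : 0 < δ := by rw [hδ]; linarith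
  obtain ⟨p, q, hp, h1, h2⟩ := exists_nat_ratio_btwn (density_nonneg U)
    (lt_add_of_pos_right (density U) hδ0)
  obtain ⟨p', q', hp', h1', h2'⟩ := exists_nat_ratio_btwn (density_nonneg V)
    (lt_add_of_pos_right (density V) hδ0)
  have hp0 : (0 : ℝ) < p := Nat.cast_pos.2 hp
  have hp0' : (0 : ℝ) < p' := Nat.cast_pos.2 hp'
  rw [lt_div_iff₀' hp0] at h1
  rw [lt_div_iff₀' hp0'] at h1'
  have h := density_mul_le hr (cardLE_union ι hM (fun x hx => ?_)
    (cardLE_of_density_lt ι hM hΩ hs h1) (cardLE_of_density_lt ι hM hΩ ht h1'))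
  · push_cast at h
    rw [← le_div_iff₀' (by positivity)] at h
    have : ((q : ℝ) * p' + q' * p) / (p * p') = q / p + q' / p' := by field_simp
    linarith
  · obtain ⟨hx, hU | hV⟩ := (hr x).1 hx
    · exact .inl ((hs x).2 ⟨hx, hU⟩)
    · exact .inr ((ht x).2 ⟨hx, hV⟩)

theorem add_le_density_union (ι : arithLang →ᴸ L) [ι.IsExpansionOn ℕ]
    (hM : L.ElementarilyEquivalent ℕ M) (hΩ : (elts L Ω).Nonempty)
    {r : M} (hs : IsCode U s) (ht : IsCode V t) (hr : IsCode (U ∪ V) r) (hd : Disjoint U V) :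
    density U + density V ≤ density (U ∪ V) := by
  -- Zero densities are treated apart: the rational lower bounds below must be nonnegative and still
  -- strictly less than the densities.
  rcases (density_nonneg U).eq_or_lt with hU0 | hU0
  · rw [← hU0, zero_add]
    exact density_mono ι hM hΩ ht hr Set.subset_union_right
  rcases (density_nonneg V).eq_or_lt with hV0 | hV0
  · rw [← hV0, add_zero]
    exact density_mono ι hM hΩ hs hr Set.subset_union_left
  by_contra! hlt
  set δ := (density U + density V - density (U ∪ V)) / 2 with hδ
  have hδ0 : 0 < δ := by rw [hδ]; linarith
  obtain ⟨p, q, hp, h1, h2⟩ := exists_nat_ratio_btwn (le_max_right (density U - δ) 0)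
    (max_lt (sub_lt_self _ hδ0) hU0)
  obtain ⟨p', q', hp', h1', h2'⟩ := exists_nat_ratio_btwn (le_max_right (density V - δ) 0)
    (max_lt (sub_lt_self _ hδ0) hV0)
  have hp0 : (0 : ℝ) < p := Nat.cast_pos.2 hp
  have hp0' : (0 : ℝ) < p' := Nat.cast_pos.2 hp'
  rw [div_lt_iff₀' hp0] at h2
  rw [div_lt_iff₀' hp0'] at h2'
  have h := le_density_mul ι hM hΩ hr (cardLE_disjoint_union ι hM (fun x hx => ?_) (fun x hx => ?_)
    (cardLE_of_lt_density ι hM hs h2) (cardLE_of_lt_density ι hM ht h2'))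
  · push_cast at h
    rw [← div_le_iff₀' (by positivity)] at h
    have : ((q : ℝ) * p' + q' * p) / (p * p') = q / p + q' / p' := by field_simp
    have h3 := (le_max_left _ _).trans_lt h1
    have h4 := (le_max_left _ _).trans_lt h1'
    linarith
  · rcases hx with hx | hx
    · obtain ⟨hx, hU⟩ := (hs x).1 hx
      exact (hr x).2 ⟨hx, .inl hU⟩
    · obtain ⟨hx, hV⟩ := (ht x).1 hx
      exact (hr x).2 ⟨hx, .inr hV⟩
  · obtain ⟨h1, hU⟩ := (hs x).1 hx.1
    obtain ⟨h2, hV⟩ := (ht x).1 hx.2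
    exact Set.disjoint_left.1 hd hU hV

end

end Density

/-! ### Definability in M of membership and size comparison -/

section Definability

variable {L : FirstOrder.Language.{u, v}} {M : Type w} [L.Structure M]

theorem definable_const_prop {α : Type*} {A : Set M} (p : Prop) :
    A.Definable L {_v : α → M | p} := by
  by_cases hp : p <;> simp [hp]

variable [L.Structure ℕ]

theorem definable_star_pair {α : Type*} {A : Set M} (R : Set (Fin 2 → ℕ)) {f g : (α → M) → M}
    (hf : A.DefinableFun L f) (hg : A.DefinableFun L g) :
    A.Definable L {v : α → M | ![f v, g v] ∈ (star L R : Set (Fin 2 → M))} := by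
  have hF : A.DefinableMap L fun v => ![f v, g v] := by
    intro i
    fin_cases i
    exacts [hf, hg]
  exact (definable_star L R A).preimage_map hF

theorem definable_mem {α : Type*} {A : Set M} {f g : (α → M) → M}
    (hf : A.DefinableFun L f) (hg : A.DefinableFun L g) :
    A.Definable L {v : α → M | Mem L (f v) (g v)} :=
  definable_star_pair _ hf hg

theorem definable_cardLE {α : Type*} {A : Set M} (k l : ℕ) {f g : (α → M) → M}
    (hf : A.DefinableFun L f) (hg : A.DefinableFun L g) :
    A.Definable L {v : α → M | CardLE L k l (f v) (g v)} :=
  definable_star_pair _ hf hg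

end Definability

/-! ### The measure on definable sets and completeness of 𝓑 -/

section Completeness

variable {L : FirstOrder.Language.{u, v}} [L.Structure ℕ] {M : Type w} [L.Structure M] {Ω : M}

/-- The standard part of `|U| / |Ω|` for a definable subset `U` of `Ω`. -/
noncomputable def measure (U : definableSubsets L Ω) : ℝ := density (U : Set (elts L Ω))

theorem measure_nonneg (U : definableSubsets L Ω) : 0 ≤ measure U := density_nonneg _

theorem measure_mono (ι : arithLang →ᴸ L) [ι.IsExpansionOn ℕ]
    (hM : L.ElementarilyEquivalent ℕ M) (hΩ : (elts L Ω).Nonempty) :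
    Monotone (measure : definableSubsets L Ω → ℝ) := by
  intro U V h
  obtain ⟨s, hs⟩ := exists_isCode ι hM U
  obtain ⟨t, ht⟩ := exists_isCode ι hM V
  exact density_mono ι hM hΩ hs ht h

theorem measure_sup_of_disjoint (ι : arithLang →ᴸ L) [ι.IsExpansionOn ℕ]
    (hM : L.ElementarilyEquivalent ℕ M) (hΩ : (elts L Ω).Nonempty) (U V : definableSubsets L Ω)
    (hd : Disjoint U V) : measure (U ⊔ V) = measure U + measure V := by
  obtain ⟨s, hs⟩ := exists_isCode ι hM U
  obtain ⟨t, ht⟩ := exists_isCode ι hM V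
  obtain ⟨r, hr⟩ := exists_isCode ι hM (U ⊔ V)
  have hd' : Disjoint (U : Set (elts L Ω)) V := by
    rw [Set.disjoint_iff_inter_eq_empty]
    exact congrArg Subtype.val (disjoint_iff.1 hd)
  exact le_antisymm (density_union_le ι hM hΩ hs ht hr)
    (add_le_density_union ι hM hΩ hs ht hr hd')

theorem measure_le_one (ι : arithLang →ᴸ L) [ι.IsExpansionOn ℕ]
    (hM : L.ElementarilyEquivalent ℕ M) (U : definableSubsets L Ω) : measure U ≤ 1 := by
  obtain ⟨s, hs⟩ := exists_isCode ι hM U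
  exact density_le_one ι hM hs

theorem measure_bot (ι : arithLang →ᴸ L) [ι.IsExpansionOn ℕ]
    (hM : L.ElementarilyEquivalent ℕ M) (hΩ : (elts L Ω).Nonempty) :
    measure (⊥ : definableSubsets L Ω) = 0 := by
  simpa using measure_sup_of_disjoint ι hM hΩ (⊥ : definableSubsets L Ω) ⊥ disjoint_bot_left

theorem measure_sup_le (ι : arithLang →ᴸ L) [ι.IsExpansionOn ℕ]
    (hM : L.ElementarilyEquivalent ℕ M) (hΩ : (elts L Ω).Nonempty) (U V : definableSubsets L Ω) :
    measure (U ⊔ V) ≤ measure U + measure V := by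
  obtain ⟨s, hs⟩ := exists_isCode ι hM U
  obtain ⟨t, ht⟩ := exists_isCode ι hM V
  obtain ⟨r, hr⟩ := exists_isCode ι hM (U ⊔ V)
  exact density_union_le ι hM hΩ hs ht hr

theorem isInfinitesimal_iff_measure (ι : arithLang →ᴸ L) [ι.IsExpansionOn ℕ]
    (hM : L.ElementarilyEquivalent ℕ M) (hΩ : (elts L Ω).Nonempty) (U : definableSubsets L Ω) :
    IsInfinitesimal L Ω (U : Set (elts L Ω)) ↔ measure U = 0 := by
  obtain ⟨s, hs⟩ := exists_isCode ι hM U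
  exact isInfinitesimal_iff ι hM hΩ hs

theorem mem_definableSubsets_of_code (s : M) :
    {x : elts L Ω | Mem L (x : M) s} ∈ definableSubsets L Ω :=
  ⟨{x | Mem L x s}, definable_mem (Set.DefinableFun.proj L)
    (L.definableFun_const _ (Set.mem_univ s)), rfl⟩

/-- An increasing sequence of definable sets has a definable upper bound that has no larger
measure. -/
theorem exists_upperBound_measure_le (ι : arithLang →ᴸ L) [ι.IsExpansionOn ℕ]
    (hM : L.ElementarilyEquivalent ℕ M) (hsat : Aleph1Saturated L M) (hΩ : (elts L Ω).Nonempty)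
    (U : ℕ → definableSubsets L Ω) (hU : Monotone U) (r : ℝ) (hr : ∀ n, measure (U n) ≤ r) :
    ∃ W, (∀ n, U n ≤ W) ∧ measure W ≤ r := by
  choose c hc using fun n => exists_isCode ι hM (U n)
  have hr0 : 0 ≤ r := (measure_nonneg _).trans (hr 0)
  -- The type of a code of a subset of Ω that contains every U n and obeys every rational bound q/p
  -- > r. A code of a late enough U n satisfies any finite part of it.
  obtain ⟨s, hs⟩ := exists_forall_mem_of_saturated hsat
    (fun i : ℕ × ℕ × ℕ => {s : M | (∀ x, Mem L x (c i.1) → Mem L x s) ∧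
      (∀ x, Mem L x s → Mem L x Ω) ∧ (i.2.1 * r < i.2.2 → CardLE L i.2.1 i.2.2 s Ω)})
    (fun i => by
      have hconst {α : Type} (m : M) :
          (Set.univ : Set M).DefinableFun L (fun _ : α → M => m) :=
        L.definableFun_const _ (Set.mem_univ m)
      have hproj {α : Type} (i : α) : (Set.univ : Set M).DefinableFun L (fun v : α → M => v i) :=
        .proj L
      exact (definable_forall (definable_imp (definable_mem (hproj none) (hconst (c i.1)))
          (definable_mem (hproj none) (hproj (some 0))))).inter
        ((definable_forall (definable_imp (definable_mem (hproj none) (hproj (some 0)))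
          (definable_mem (hproj none) (hconst Ω)))).inter
        (definable_imp (definable_const_prop _)
          (definable_cardLE i.2.1 i.2.2 (hproj 0) (hconst Ω)))))
    (fun t => by
      refine ⟨c (t.sup Prod.fst), fun i hi => ⟨fun x hx => ?_, fun x hx => ((hc _ x).1 hx).1,
        fun h => cardLE_of_density_lt ι hM hΩ (hc _) (lt_of_le_of_lt ?_ h)⟩⟩
      · obtain ⟨hx, hxU⟩ := (hc _ x).1 hx
        exact (hc _ x).2 ⟨hx, hU (Finset.le_sup (f := Prod.fst) hi) hxU⟩
      · exact mul_le_mul_of_nonneg_left (hr _) (Nat.cast_nonneg _))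
  refine ⟨⟨_, mem_definableSubsets_of_code s⟩, fun n x hx => ?_, ?_⟩
  · exact (hs (n, 0, 0)).1 _ ((hc n x).2 ⟨x.2, hx⟩)
  · by_contra! hlt
    obtain ⟨p, q, hp, h1, h2⟩ := exists_nat_ratio_btwn hr0 hlt
    have hp' : (0 : ℝ) < p := Nat.cast_pos.2 hp
    rw [lt_div_iff₀' hp'] at h1
    rw [div_lt_iff₀' hp'] at h2
    have hcode : IsCode {x : elts L Ω | Mem L (x : M) s} s := fun x =>
      ⟨fun hx => ⟨(hs (0, 0, 0)).2.1 x hx, hx⟩, fun ⟨_, hx⟩ => hx⟩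
    exact h2.not_ge (density_mul_le hcode ((hs (0, p, q)).2.2 h1))

theorem exists_null_union_definableSubsets (ι : arithLang →ᴸ L) [ι.IsExpansionOn ℕ]
    (hM : L.ElementarilyEquivalent ℕ M) (hsat : Aleph1Saturated L M) (hΩ : (elts L Ω).Nonempty)
    {S : Set (definableSubsets L Ω)} (hne : S.Nonempty) (hdir : DirectedOn (· ≤ ·) S) :
    ∃ W, (∀ U ∈ S, measure (U \ W) = 0) ∧ ∀ ε > 0, ∃ U ∈ S, measure (W \ U) < ε :=
  exists_null_union (measure_mono ι hM hΩ) (measure_sup_of_disjoint ι hM hΩ)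
    (measure_le_one ι hM) (exists_upperBound_measure_le ι hM hsat hΩ) hne hdir

/-- Monotonicity and subadditivity of the measure make the null sets an ideal, so passing to the
span adds no sets. -/
theorem mem_infinitesimalIdeal (ι : arithLang →ᴸ L) [ι.IsExpansionOn ℕ]
    (hM : L.ElementarilyEquivalent ℕ M) (hΩ : (elts L Ω).Nonempty)
    (U : AsBoolRing (definableSubsets L Ω)) :
    U ∈ infinitesimalIdeal L Ω ↔ measure (ofBoolRing U) = 0 := by
  have hmono := measure_mono ι hM hΩ
  constructor
  · intro h
    refine Submodule.span_induction (p := fun U _ => measure (ofBoolRing U) = 0)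
      (fun U hU => (isInfinitesimal_iff_measure ι hM hΩ _).1 hU) ?_ (fun U V _ _ hU hV => ?_)
      (fun U V _ hV => ?_) h
    · exact measure_bot ι hM hΩ
    · refine le_antisymm ?_ (measure_nonneg _)
      rw [ofBoolRing_add]
      refine (hmono (symmDiff_le_sup)).trans ((measure_sup_le ι hM hΩ _ _).trans ?_)
      rw [hU, hV, add_zero]
    · refine le_antisymm ?_ (measure_nonneg _)
      rw [smul_eq_mul, ofBoolRing_mul, ← hV]
      exact hmono inf_le_right
  · exact fun h => Submodule.subset_span ((isInfinitesimal_iff_measure ι hM hΩ _).2 h)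

variable (L Ω) in
/-- `cls` as a homomorphism. -/
noncomputable def clsHom : BoundedLatticeHom (definableSubsets L Ω) (TruthValues L Ω) :=
  (Ideal.Quotient.mk (infinitesimalIdeal L Ω)).asBoolAlg.comp
    ((OrderIso.asBoolAlgAsBoolRing (definableSubsets L Ω)).symm :
      BoundedLatticeHom (definableSubsets L Ω) (AsBoolAlg (AsBoolRing (definableSubsets L Ω))))

theorem clsHom_apply (U : definableSubsets L Ω) : clsHom L Ω U = cls L Ω U := rfl

theorem cls_bot : cls L Ω ⊥ = ⊥ := map_bot (clsHom L Ω)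

theorem cls_himp (U V : definableSubsets L Ω) : cls L Ω (U ⇨ V) = cls L Ω U ⇨ cls L Ω V :=
  map_himp (clsHom L Ω) U V

theorem cls_sdiff (U V : definableSubsets L Ω) : cls L Ω (U \ V) = cls L Ω U \ cls L Ω V :=
  map_sdiff (clsHom L Ω) U V

theorem cls_surjective : Function.Surjective (cls L Ω) := by
  intro b
  obtain ⟨a, ha⟩ := Ideal.Quotient.mk_surjective (ofBoolAlg b)
  exact ⟨ofBoolRing a, congrArg toBoolAlg ha⟩

theorem cls_le_cls_iff (ι : arithLang →ᴸ L) [ι.IsExpansionOn ℕ]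
    (hM : L.ElementarilyEquivalent ℕ M) (hΩ : (elts L Ω).Nonempty) {U V : definableSubsets L Ω} :
    cls L Ω U ≤ cls L Ω V ↔ measure (U \ V) = 0 := by
  rw [← sdiff_eq_bot_iff, ← cls_sdiff, ← ofBoolRing_toBoolRing (U \ V),
    ← mem_infinitesimalIdeal ι hM hΩ, ← Ideal.Quotient.eq_zero_iff_mem]
  exact toBoolAlg_inj (α := QuotRing L Ω) (b := 0)

theorem measure_sdiff_trans (ι : arithLang →ᴸ L) [ι.IsExpansionOn ℕ]
    (hM : L.ElementarilyEquivalent ℕ M) (hΩ : (elts L Ω).Nonempty) (U V W : definableSubsets L Ω) :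
    measure (U \ W) ≤ measure (U \ V) + measure (V \ W) :=
  measure_sdiff_le (measure_mono ι hM hΩ) (measure_sup_of_disjoint ι hM hΩ) U V W

/-- If T represents an upper bound, W \ T is covered by W \ U, which is small, and U \ T, which is
null. -/
theorem isLUB_cls (ι : arithLang →ᴸ L) [ι.IsExpansionOn ℕ]
    (hM : L.ElementarilyEquivalent ℕ M) (hΩ : (elts L Ω).Nonempty) {S : Set (definableSubsets L Ω)}
    {W : definableSubsets L Ω} (h1 : ∀ U ∈ S, measure (U \ W) = 0)
    (h2 : ∀ ε > 0, ∃ U ∈ S, measure (W \ U) < ε) : IsLUB (cls L Ω '' S) (cls L Ω W) := by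
  refine ⟨?_, fun c hc => ?_⟩
  · rintro _ ⟨U, hU, rfl⟩
    exact (cls_le_cls_iff ι hM hΩ).2 (h1 U hU)
  · obtain ⟨T, rfl⟩ := cls_surjective c
    rw [cls_le_cls_iff ι hM hΩ]
    refine le_antisymm (le_of_forall_pos_lt_add fun ε hε => ?_) (measure_nonneg _)
    obtain ⟨U, hU, hlt⟩ := h2 ε hε
    have h3 := (cls_le_cls_iff ι hM hΩ).1 (hc ⟨U, hU, rfl⟩)
    linarith [measure_sdiff_trans ι hM hΩ W U T]

/-- The least upper bound of a directed family is approximated in measure by its members. -/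
theorem exists_measure_sdiff_lt (ι : arithLang →ᴸ L) [ι.IsExpansionOn ℕ]
    (hM : L.ElementarilyEquivalent ℕ M) (hsat : Aleph1Saturated L M) (hΩ : (elts L Ω).Nonempty)
    {S : Set (definableSubsets L Ω)} (hne : S.Nonempty) (hdir : DirectedOn (· ≤ ·) S)
    {b : TruthValues L Ω} (hb : IsLUB (cls L Ω '' S) b) {T : definableSubsets L Ω}
    (hT : cls L Ω T ≤ b) {ε : ℝ} (hε : 0 < ε) : ∃ U ∈ S, measure (T \ U) < ε := by
  obtain ⟨W, h1, h2⟩ := exists_null_union_definableSubsets ι hM hsat hΩ hne hdir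
  obtain rfl := hb.unique (isLUB_cls ι hM hΩ h1 h2)
  obtain ⟨U, hU, hlt⟩ := h2 ε hε
  refine ⟨U, hU, ?_⟩
  have := (cls_le_cls_iff ι hM hΩ).1 hT
  linarith [measure_sdiff_trans ι hM hΩ T W U]

theorem exists_isLUB (ι : arithLang →ᴸ L) [ι.IsExpansionOn ℕ]
    (hM : L.ElementarilyEquivalent ℕ M) (hsat : Aleph1Saturated L M) (hΩ : (elts L Ω).Nonempty)
    (S : Set (TruthValues L Ω)) : ∃ b, IsLUB S b := by
  classical
  -- Finite unions of representatives form a directed family with the same upper bounds in 𝓑. The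
  -- empty union keeps it nonempty even if S is empty.
  set D : Set (definableSubsets L Ω) :=
    {U | ∃ t : Finset (definableSubsets L Ω), (∀ V ∈ t, cls L Ω V ∈ S) ∧ U = t.sup id}
  have hdir : DirectedOn (· ≤ ·) D := by
    rintro _ ⟨t, ht, rfl⟩ _ ⟨t', ht', rfl⟩
    refine ⟨_, ⟨t ∪ t', fun V hV => ?_, rfl⟩, Finset.sup_mono Finset.subset_union_left,
      Finset.sup_mono Finset.subset_union_right⟩
    exact (Finset.mem_union.1 hV).elim (ht V) (ht' V)
  obtain ⟨W, h1, h2⟩ := exists_null_union_definableSubsets ι hM hsat hΩ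
    (S := D) ⟨_, ∅, by simp, rfl⟩ hdir
  have hW := isLUB_cls ι hM hΩ h1 h2
  refine ⟨cls L Ω W, fun b hb => ?_, fun c hc => hW.2 ?_⟩
  · obtain ⟨V, rfl⟩ := cls_surjective b
    exact hW.1 ⟨V, ⟨{V}, by simpa using hb, by simp⟩, rfl⟩
  · rintro _ ⟨_, ⟨t, ht, rfl⟩, rfl⟩
    rw [← clsHom_apply, map_finset_sup]
    exact Finset.sup_le fun V hV => hc (ht V hV)

theorem exists_isGLB (ι : arithLang →ᴸ L) [ι.IsExpansionOn ℕ]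
    (hM : L.ElementarilyEquivalent ℕ M) (hsat : Aleph1Saturated L M) (hΩ : (elts L Ω).Nonempty)
    (S : Set (TruthValues L Ω)) : ∃ b, IsGLB S b := by
  obtain ⟨b, hb⟩ := exists_isLUB ι hM hsat hΩ (lowerBounds S)
  exact ⟨b, isLUB_lowerBounds.1 hb⟩

end Completeness

/-! ### Definability and truth values of open formulas -/

section OpenFormulas

open Set

variable {L : FirstOrder.Language.{u, v}} {M : Type w} [L.Structure M]

theorem definableFun_realize_term {α β : Type*} {A : Set M} (t : L.Term β)
    {g : β → (α → M) → M} (hg : ∀ b, A.DefinableFun L (g b)) :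
    A.DefinableFun L fun f => t.realize fun b => g b f := by
  induction t with
  | var b => exact hg b
  | func k ts ih =>
    exact Set.DefinableFun.comp (g := fun f i => (ts i).realize fun b => g b f) ih
      (Set.DefinableFun.fun_symbol k).of_empty

theorem definable_realize_of_isQF {α β : Type*} {A : Set M} {n : ℕ} {φ : L.BoundedFormula β n}
    (hφ : φ.IsQF) {g : β → (α → M) → M} {h : Fin n → (α → M) → M}
    (hg : ∀ b, A.DefinableFun L (g b)) (hh : ∀ i, A.DefinableFun L (h i)) :
    A.Definable L {f : α → M | φ.Realize (fun b => g b f) fun i => h i f} := by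
  have ht (t : L.Term (β ⊕ Fin n)) : A.DefinableFun L
      fun f : α → M => t.realize (Sum.elim (fun b => g b f) fun i => h i f) := by
    have := definableFun_realize_term (A := A) t (g := Sum.elim g h)
      (by rintro (b | i); exacts [hg b, hh i])
    convert this using 3 with f
    funext b
    cases b <;> rfl
  induction hφ with
  | falsum => exact Set.definable_empty
  | of_isAtomic hφ =>
    cases hφ with
    | equal t₁ t₂ => exact (ht t₁).ofPred_eq (ht t₂)
    | @rel l R ts =>
      have hR : A.Definable L {y : Fin l → M | Language.Structure.RelMap R y} := by
        refine Set.Definable.mono (A := ∅) ?_ (Set.empty_subset _)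
        rw [Set.empty_definable_iff]
        refine ⟨R.formula fun i => Language.Term.var i, Set.ext fun y => ?_⟩
        simp [Language.Formula.realize_rel]
      have := hR.preimage_map
        (F := fun (f : α → M) i => (ts i).realize (Sum.elim (fun b => g b f) fun i => h i f))
        fun i => ht (ts i)
      convert this using 1
      ext f
      simp [Language.BoundedFormula.realize_rel]
  | imp _ _ h1 h2 => exact definable_imp h1 h2

theorem isQF_iInf {β γ : Type*} [Finite β] {n : ℕ} {f : β → L.BoundedFormula γ n}
    (h : ∀ b, (f b).IsQF) : (Language.BoundedFormula.iInf f).IsQF := by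
  have (l : List β) : ((l.map f).foldr (· ⊓ ·) ⊤).IsQF := by
    induction l with
    | nil => exact .top
    | cons b l ih => exact (h b).inf ih
  exact this _

theorem definable_existsUnique_of_definable {α : Type*} {A : Set M} {P : (Option α → M) → Prop}
    (h : A.Definable L {f | P f}) :
    A.Definable L {f : α → M | ∃! y, P fun o => o.elim y f} := by
  have h1 : A.Definable L {f : Option (Option α) → M |
      P fun o => o.elim (f none) (f ∘ some ∘ some)} := by
    convert h.preimage_comp (fun o => o.elim none (some ∘ some) : Option α → Option (Option α))
      using 1
    ext f
    refine iff_of_eq (congrArg P ?_)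
    funext o
    cases o <;> rfl
  have h2 : A.Definable L {f : Option (Option α) → M | f none = f (some none)} :=
    (Set.DefinableFun.proj L).ofPred_eq (Set.DefinableFun.proj L)
  have h3 : A.Definable L {f : Option α → M | P fun o => o.elim (f none) (f ∘ some)} := by
    convert h using 1
    ext f
    refine iff_of_eq (congrArg P ?_)
    funext o
    cases o <;> rfl
  exact definable_exists (P := fun f => (P fun o => o.elim (f none) (f ∘ some)) ∧
    ∀ z, (P fun o => o.elim z (f ∘ some)) → z = f none) (h3.inter (definable_forall
      (P := fun f => (P fun o => o.elim (f none) (f ∘ some ∘ some)) → f none = f (some none))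
      (definable_imp h1 h2)))

theorem definable₁_realize_numeral (H : L.Formula (M ⊕ Fin 2)) (m : M) :
    (Set.univ : Set M).Definable₁ L {b | H.Realize (Sum.elim id ![m, b])} := by
  refine Set.definable_iff_exists_formula_sum.2 ⟨H.relabel (Sum.elim
    (fun a => Sum.inl ⟨a, Set.mem_univ a⟩) ![Sum.inl ⟨m, Set.mem_univ m⟩, Sum.inr 0]), ?_⟩
  ext x
  simp only [Set.mem_ofPred_eq, Language.Formula.realize_relabel]
  refine iff_of_eq (congrArg _ ?_)
  funext k
  rcases k with k | k
  · rfl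
  · fin_cases k <;> rfl

variable [L.Structure ℕ]

theorem definable_pairMem_fun {α : Type*} {A : Set M} {f g h : (α → M) → M}
    (hf : A.DefinableFun L f) (hg : A.DefinableFun L g) (hh : A.DefinableFun L h) :
    A.Definable L {v : α → M | PairMem L (f v) (g v) (h v)} := by
  have hF : A.DefinableMap L fun v => ![f v, g v, h v] := by
    intro i
    fin_cases i
    exacts [hf, hg, hh]
  exact (definable_star L _ A).preimage_map hF

/-- Here the code of the function may vary along with its argument, as is needed for definable
conditions on the random variable sought. The default value of `ev` keeps it total on all of M. -/
theorem definableFun_ev_fun {α : Type*} {A : Set M} {g h : (α → M) → M}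
    (hg : A.DefinableFun L g) (hh : A.DefinableFun L h) :
    A.DefinableFun L fun f : α → M => ev L (g f) (h f) := by
  have hg' := definableFun_reindex hg (some : α → Option α)
  have hh' := definableFun_reindex hh (some : α → Option α)
  have hg'' := definableFun_reindex hg (some ∘ some : α → Option (Option α))
  have hh'' := definableFun_reindex hh (some ∘ some : α → Option (Option α))
  have hU : A.Definable L {f : Option α → M | ∃! y, PairMem L (g (f ∘ some)) (h (f ∘ some)) y} :=
    definable_existsUnique_of_definable
      (P := fun f => PairMem L (g (f ∘ some ∘ some)) (h (f ∘ some ∘ some)) (f none))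
      (definable_pairMem_fun hg'' hh'' (.proj L))
  have h1 := hU.inter (definable_pairMem_fun hg' hh' (Set.DefinableFun.proj L (i := none)))
  have h2 := hU.compl.inter (hh'.ofPred_eq (Set.DefinableFun.proj L (i := none)))
  unfold Set.DefinableFun
  convert h1.union h2 using 1
  ext f
  by_cases hu : ∃! y, PairMem L (g (f ∘ some)) (h (f ∘ some)) y
  · have he : ev L (g (f ∘ some)) (h (f ∘ some)) = hu.choose := dif_pos hu
    simp only [Function.tupleGraph, Set.mem_ofPred_eq, Set.mem_union, Set.mem_inter_iff,
      Set.mem_compl_iff, hu, not_true_eq_false, false_and, or_false, true_and, he]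
    exact ⟨fun hf => hf ▸ hu.choose_spec.1, fun hf => (hu.choose_spec.2 _ hf).symm⟩
  · have he : ev L (g (f ∘ some)) (h (f ∘ some)) = h (f ∘ some) := dif_neg hu
    simp only [Function.tupleGraph, Set.mem_ofPred_eq, Set.mem_union, Set.mem_inter_iff,
      Set.mem_compl_iff, hu, not_false_eq_true, false_and, false_or, true_and, he]

variable {F : Set M} {n : ℕ}

/-- The open `L(F)`-formula `A` holds at `x` when its variables are interpreted by `e`. -/
def HoldsAt (A : L.BoundedFormula F n) (e : Fin n → M) (x : M) : Prop :=
  A.Realize (fun δ : F => ev L (δ : M) x) fun i => ev L (e i) x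

/-- The set of all `x ∈ Ω` where the open `L(F)`-formula `A` holds. -/
def openSet (Ω : M) {A : L.BoundedFormula F n} (hA : A.IsQF) (e : Fin n → M) :
    definableSubsets L Ω :=
  ⟨{x | HoldsAt A e x}, {x | HoldsAt A e x}, definable_realize_of_isQF hA
    (g := fun (δ : F) f => ev L (δ : M) (f 0)) (h := fun i f => ev L (e i) (f 0))
    (fun δ => definableFun_ev L (δ : M) 0) (fun i => definableFun_ev L (e i) 0), rfl⟩

/-- Passing to classes modulo the ideal is a Boolean homomorphism, so open formulas can be evaluated
pointwise. -/
theorem truth_of_isQF (Ω : M) {A : L.BoundedFormula F n} (hA : A.IsQF) (e : Fin n → F) :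
    truth L Ω F A e = cls L Ω (openSet Ω hA fun i => (e i : M)) := by
  induction hA with
  | falsum => exact cls_bot.symm
  | of_isAtomic hA =>
    cases hA with
    | equal t₁ t₂ => exact congrArg (cls L Ω) (Subtype.ext rfl)
    | rel R ts => exact congrArg (cls L Ω) (Subtype.ext rfl)
  | imp h1 h2 ih1 ih2 =>
    rw [truth, ih1, ih2, ← cls_himp]
    congr 1

end OpenFormulas

/-! ### Witnesses for open formulas and realization of types -/

section Types

variable {L : FirstOrder.Language.{u, v}} [L.Structure ℕ] {M : Type w} [L.Structure M] {Ω : M}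
  {F : Set M}

/-- Let γ be α where A(α) holds and β elsewhere. Then A(γ) holds wherever A(α) or A(β) does. -/
theorem directedOn_openSet (hcases : ClosedUnderCases L Ω F) {A : L.BoundedFormula F 1}
    (hA : A.IsQF) :
    DirectedOn (· ≤ ·) (Set.range fun α : F => openSet Ω hA fun _ => (α : M)) := by
  rintro _ ⟨α, rfl⟩ _ ⟨β, rfl⟩
  obtain ⟨γ, hγ⟩ := hcases α β A hA
  have key (x : elts L Ω) (δ : F) (h : ev L (γ : M) x = ev L (δ : M) x)
      (hδ : HoldsAt A (fun _ => (δ : M)) (x : M)) : HoldsAt A (fun _ => (γ : M)) (x : M) := by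
    unfold HoldsAt at hδ ⊢
    simpa only [h] using hδ
  refine ⟨_, ⟨γ, rfl⟩, fun x hx => ?_, fun x hx => ?_⟩
  · exact key x α ((hγ x x.2).1 hx) hx
  · by_cases hα : HoldsAt A (fun _ => (α : M)) (x : M)
    · exact key x α ((hγ x x.2).1 hα) hα
    · exact key x β ((hγ x x.2).2 hα) hx

/-- The supremum defining ⟦∃x A⟧ need not be attained, but the family is directed, so a single
member of F comes within ε of it. -/
theorem exists_measure_sdiff_openSet_lt (ι : arithLang →ᴸ L) [ι.IsExpansionOn ℕ]
    (hM : L.ElementarilyEquivalent ℕ M) (hsat : Aleph1Saturated L M) (hΩ : (elts L Ω).Nonempty)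
    (hne : F.Nonempty) (hcases : ClosedUnderCases L Ω F) {A : L.BoundedFormula F 1} (hA : A.IsQF)
    {T : definableSubsets L Ω} (hT : cls L Ω T ≤ truth L Ω F A.ex ![]) {ε : ℝ} (hε : 0 < ε) :
    ∃ α ∈ F, measure (T \ openSet Ω hA fun _ => α) < ε := by
  have hlub := truth_ex L Ω F A ![] (exists_isGLB ι hM hsat hΩ)
  have heq : (Set.range fun α : F => truth L Ω F A (Fin.snoc ![] α)) =
      cls L Ω '' Set.range fun α : F => openSet Ω hA fun _ => (α : M) := by
    rw [← Set.range_comp]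
    congr 1
    funext α
    rw [truth_of_isQF Ω hA]
    congr 2
  rw [heq] at hlub
  have : Nonempty F := hne.to_subtype
  obtain ⟨_, ⟨α, rfl⟩, h⟩ := exists_measure_sdiff_lt ι hM hsat hΩ (Set.range_nonempty _)
    (directedOn_openSet hcases hA) hlub hT hε
  exact ⟨α, α.2, h⟩

/-- Stated for arbitrary a in M: F itself need not be definable, and saturation searches all of M.
-/
theorem definable₁_small_failure (Ω w : M) (k : ℕ) {A : L.BoundedFormula F 1} (hA : A.IsQF) :
    (Set.univ : Set M).Definable₁ L {a | ∃ s, (∀ x, Mem L x s ↔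
      Mem L x w ∧ ¬ HoldsAt A (fun _ => a) x) ∧ CardLE L k 1 s Ω} := by
  have hconst {α : Type} (m : M) : (Set.univ : Set M).DefinableFun L (fun _ : α → M => m) :=
    L.definableFun_const _ (Set.mem_univ m)
  have hproj {α : Type} (i : α) : (Set.univ : Set M).DefinableFun L (fun v : α → M => v i) :=
    .proj L
  have h1 : (Set.univ : Set M).Definable L {v : Option (Option (Fin 1)) → M |
      Mem L (v none) (v (some none))} := definable_mem (hproj _) (hproj _)
  have h2 : (Set.univ : Set M).Definable L {v : Option (Option (Fin 1)) → M |
      Mem L (v none) w} := definable_mem (hproj _) (hconst _)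
  have h3 : (Set.univ : Set M).Definable L {v : Option (Option (Fin 1)) → M |
      HoldsAt A (fun _ => v (some (some 0))) (v none)} :=
    definable_realize_of_isQF hA (fun δ => definableFun_ev L (δ : M) none)
      fun _ => definableFun_ev_fun (hproj _) (hproj _)
  have h5 := definable_forall (P := fun v : Option (Option (Fin 1)) → M =>
      Mem L (v none) (v (some none)) ↔ Mem L (v none) w ∧
        ¬ HoldsAt A (fun _ => v (some (some 0))) (v none)) (definable_iff h1 (h2.inter h3.compl))
  exact definable_exists (h5.inter (definable_cardLE k 1 (hproj none) (hconst Ω)))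

theorem exists_realizesSatur (ι : arithLang →ᴸ L) [ι.IsExpansionOn ℕ]
    (hM : L.ElementarilyEquivalent ℕ M) (hsat : Aleph1Saturated L M) (hΩ : (elts L Ω).Nonempty)
    (hne : F.Nonempty) (hcases : ClosedUnderCases L Ω F) (hcompact : Compact ι F)
    {p : Set (L.BoundedFormula F 1)} (hp : p.Countable) (hopen : ∀ A ∈ p, A.IsQF) :
    ∃ u : F, RealizesSatur L Ω F p u := by
  classical
  obtain ⟨H, hH, -⟩ := hcompact
  have hglb := fun S => isGLB_glb (exists_isGLB ι hM hsat hΩ (S := S))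
  set B : Set (TruthValues L Ω) := {b | ∃ Φ : Finset (L.BoundedFormula F 1),
      (Φ : Set (L.BoundedFormula F 1)) ⊆ p ∧
      b = truth L Ω F (Language.BoundedFormula.iInf fun A : Φ => (A : L.BoundedFormula F 1)).ex
        ![]} with hB
  obtain ⟨T, hT⟩ := cls_surjective (glb B)
  obtain ⟨w, hw⟩ := exists_isCode ι hM T
  have : Countable p := hp.to_subtype
  -- The left summand lists the conditions H(k, ·) that force membership in F; the right one
  -- requires the part of T where A fails to have size at most |Ω|/k.
  let D : ℕ ⊕ p × ℕ → Set M := Sum.elim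
    (fun k => {b | H.Realize (Sum.elim id ![numeral ι M k, b])})
    (fun i => {a | ∃ s, (∀ x, Mem L x s ↔
      Mem L x w ∧ ¬ HoldsAt (i.1 : L.BoundedFormula F 1) (fun _ => a) x) ∧ CardLE L i.2 1 s Ω})
  have hcode {A : L.BoundedFormula F 1} (hA : A.IsQF) (a s : M) :
      (∀ x, Mem L x s ↔ Mem L x w ∧ ¬ HoldsAt A (fun _ => a) x) ↔
        IsCode ((T \ openSet Ω hA fun _ => a : definableSubsets L Ω) : Set (elts L Ω)) s := by
    refine forall_congr' fun x => iff_congr Iff.rfl ⟨fun ⟨h1, h2⟩ => ?_, fun ⟨h1, h2, h3⟩ => ?_⟩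
    · obtain ⟨hx, hxT⟩ := (hw x).1 h1
      exact ⟨hx, hxT, h2⟩
    · exact ⟨(hw x).2 ⟨h1, h2⟩, h3⟩
  obtain ⟨u, hu⟩ := exists_forall_mem_of_saturated hsat D
    (by
      rintro (k | ⟨A, k⟩)
      · exact definable₁_realize_numeral H _
      · exact definable₁_small_failure Ω w k (hopen A A.2))
    (fun t => by
      set Φ : Finset (L.BoundedFormula F 1) := t.toRight.image fun i => (i.1 : L.BoundedFormula F 1)
      have hΦ : (Φ : Set (L.BoundedFormula F 1)) ⊆ p := by
        intro A hA
        obtain ⟨i, -, rfl⟩ := Finset.mem_image.1 hA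
        exact i.1.2
      have hψ := isQF_iInf (f := fun A : Φ => (A : L.BoundedFormula F 1))
        fun A => hopen A (hΦ A.2)
      -- All the bounds k in the finite part are at most K. A witness for the conjunction of Φ that
      -- fails on measure below 1/(K + 1) therefore meets all of them.
      set K := t.toRight.sup Prod.snd
      obtain ⟨α, hα, hlt⟩ := exists_measure_sdiff_openSet_lt ι hM hsat hΩ hne hcases hψ
        (hT.le.trans ((hglb B).1 ⟨Φ, hΦ, rfl⟩)) (Nat.one_div_pos_of_nat (α := ℝ) (n := K))
      refine ⟨α, ?_⟩
      rintro (k | ⟨A, k⟩) hi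
      · rw [← hH] at hα
        exact Set.mem_iInter.1 hα k
      · have hA := hopen A A.2
        obtain ⟨s, hs⟩ := exists_isCode ι hM (T \ openSet Ω hA fun _ => α)
        refine ⟨s, (hcode hA α s).2 hs, cardLE_of_density_lt ι hM hΩ hs ?_⟩
        have hi' := Finset.mem_toRight.2 hi
        have h1 : openSet Ω hψ (fun _ => α) ≤ openSet Ω hA fun _ => α := by
          intro x hx
          exact Language.BoundedFormula.realize_iInf.1 hx
            ⟨A, Finset.mem_image.2 ⟨(A, k), hi', rfl⟩⟩
        have h2 := (measure_mono ι hM hΩ (sdiff_le_sdiff_left h1 (c := T))).trans_lt hlt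
        have hk : (k : ℝ) ≤ K := Nat.cast_le.2 (Finset.le_sup (f := Prod.snd) hi')
        rw [lt_div_iff₀ (by positivity)] at h2
        have h3 := measure_nonneg (T \ openSet Ω hA fun _ => α)
        change (k : ℝ) * measure (T \ openSet Ω hA fun _ => α) < (1 : ℕ)
        push_cast
        nlinarith)
  have huF : u ∈ F := by
    rw [← hH]
    exact Set.mem_iInter.2 fun k => hu (Sum.inl k)
  refine ⟨⟨u, huF⟩, (hglb _).2 ?_⟩
  rintro _ ⟨A, hA, rfl⟩
  have hQ := hopen A hA
  change glb B ≤ _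
  rw [← hT, truth_of_isQF Ω hQ, cls_le_cls_iff ι hM hΩ, ← isInfinitesimal_iff_measure ι hM hΩ]
  have he : (fun i => ((![⟨u, huF⟩] : Fin 1 → F) i : M)) = fun _ => u := by
    funext i
    rw [Subsingleton.elim i 0]
    rfl
  rw [he]
  obtain ⟨s, hs⟩ := exists_isCode ι hM (T \ openSet Ω hQ fun _ => u)
  refine ⟨s, hs, fun k => (mulCardLE_iff _ _ _).2 ?_⟩
  -- The code supplied by the type depends on k a priori; uniqueness of codes identifies it with the
  -- fixed s.
  obtain ⟨s', hs', hk⟩ := hu (Sum.inr (⟨A, hA⟩, k))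
  obtain rfl : s' = s := ext_of_mem ι hM fun x => (((hcode hQ u s').1 hs') x).trans (hs x).symm
  exact hk

end Types

end RandomForcing

theorem theorem3p2
    (L : FirstOrder.Language.{u, v}) (ι : arithLang →ᴸ L) [L.Structure ℕ] [ι.IsExpansionOn ℕ]
    (M : Type w) [L.Structure M] (hM : L.ElementarilyEquivalent ℕ M)
    (hsat : Aleph1Saturated L M)
    (Ω : M) (hΩ : (RandomForcing.elts L Ω).Infinite)
    (F : Set M) (hF : ∀ b ∈ F, RandomForcing.IsRandomVariable L Ω b)
    (hclosed : RandomForcing.LClosed L Ω F)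
    (hcases : RandomForcing.ClosedUnderCases L Ω F)
    (hcompact : RandomForcing.Compact ι F)
    (p : Set (L.BoundedFormula F 1)) (hp : p.Countable) (hopen : ∀ A ∈ p, A.IsQF) :
    (∀ S : Set (RandomForcing.TruthValues L Ω), (∃ b, IsLUB S b) ∧ ∃ b, IsGLB S b) ∧
      ∃ u : F, RandomForcing.RealizesSatur L Ω F p u := by
  -- The constant symbol 0 names an element of F.
  have hne : F.Nonempty := by
    obtain ⟨γ, -⟩ := hclosed 0 (ι.onFunction ArithFunc.zero) Fin.elim0
    exact ⟨γ, γ.2⟩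
  exact ⟨fun S => ⟨RandomForcing.exists_isLUB ι hM hsat hΩ.nonempty S,
    RandomForcing.exists_isGLB ι hM hsat hΩ.nonempty S⟩,
    RandomForcing.exists_realizesSatur ι hM hsat hΩ.nonempty hne hcases hcompact hp hopen⟩
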